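/- **Theorem (Darboux–Carathéodory).** Let $(M,\omega)$ be a smooth symplectic manifold of dimension $2n$ and let $F=(f_1,\dots,f_n):M\to\mathbb{R}^n$ be a smooth map such that $(M,\omega,F)$ is an integrable system: $\{f_i,f_j\}=0$ for all $i,j$, where $\{f,g\}=\omega(X_f,X_g)$ and $\omega(X_f,\cdot)=-\mathrm{d}f$, and $\mathrm{d}_pF$ is onto for almost every $p\in M$. Let $m\in M$ be a regular point, i.e. $\mathrm{d}_mF$ has rank $n$. On $\mathbb{R}^{2n}$ with coordinates $(x,\xi)=(x_1,\dots,x_n,\xi_1,\dots,\xi_n)$ put $\omega_{\mathrm{can}}=\sum_{i=1}^n\mathrm{d}\xi_i\wedge\mathrm{d}x_i$ and regard $\xi$ as a map $\mathbb{R}^{2n}\to\mathbb{R}^n$. 1. There exist open neighbourhoods $U\subset M$ of $m$ and $V\subset\mathbb{R}^{2n}$ of the origin such that $(U,\omega|_U,(F-F(m))|_U)$ is strongly symplectically equivalent to $(V,\omega_{\mathrm{can}}|_V,\xi|_V)$ via a pair of the form $(\varphi,\mathrm{id})$ with $\varphi(m)=0$. That is, $F(U)-F(m)=\xi(V)$,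 and there is a diffeomorphism $\varphi:U\to V$ with $\varphi(m)=0$, $\varphi^*(\omega_{\mathrm{can}}|_V)=\omega|_U$ and $\xi\circ\varphi=F-F(m)$ on $U$. 2. Equivalently, the functions $f_i-f_i(m)$ extend to local Darboux coordinates centred at $m$: there exist an open neighbourhood $U$ of $m$ and functions $x_1,\dots,x_n$ vanishing at $m$ such that $(x_1,\dots,x_n,f_1-f_1(m),\dots,f_n-f_n(m))$ is a smooth coordinate chart of $M$ with domain $U$, and $\omega=\sum_{i=1}^n\mathrm{d}f_i\wedge\mathrm{d}x_i$ on $U$. -/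

import Mathlib

open Set Function MeasureTheory TopologicalSpace
open scoped Manifold ContDiff

noncomputable section

namespace DarbouxCaratheodory

/-! ### Linear algebra of two-forms -/

/-- The wedge product `α ∧ β` of two covectors,
`(α ∧ β)(v, w) = α(v) β(w) - α(w) β(v)`. -/
def wedge {V : Type*} [AddCommGroup V] [Module ℝ V] [TopologicalSpace V]
    (α β : V →L[ℝ] ℝ) : V [⋀^Fin 2]→L[ℝ] ℝ where
  toFun v := α (v 0) * β (v 1) - α (v 1) * β (v 0)
  map_update_add' v i x y := by
    fin_cases i <;> simp <;> ring
  map_update_smul' v i c x := by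
    fin_cases i <;> simp <;> ring
  map_eq_zero_of_eq' v i j h hij := by
    fin_cases i <;> fin_cases j <;> simp_all
  cont := by fun_prop

theorem wedge_apply {V : Type*} [AddCommGroup V] [Module ℝ V] [TopologicalSpace V]
    (α β : V →L[ℝ] ℝ) (v w : V) : wedge α β ![v, w] = α v * β w - α w * β v := rfl

/-! ### Two-forms on `2n`-dimensional manifolds -/

/-- The model space `ℝ²ⁿ`. -/
abbrev R2 (n : ℕ) : Type := EuclideanSpace ℝ (Fin (2 * n))

/-- The space `ℝⁿ` of values of a system with `n` degrees of freedom. -/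
abbrev R1 (n : ℕ) : Type := EuclideanSpace ℝ (Fin n)

/-- A field of alternating bilinear forms on the tangent spaces of a `2n`-dimensional manifold
(no regularity is included). -/
abbrev TwoForm (n : ℕ) (M : Type*) [TopologicalSpace M] [ChartedSpace (R2 n) M] : Type _ :=
  (p : M) → TangentSpace (𝓡 (2 * n)) p [⋀^Fin 2]→L[ℝ] ℝ

/-- The pullback `f^* σ` of a two-form. -/
def pullback {n : ℕ} {M N : Type*} [TopologicalSpace M] [ChartedSpace (R2 n) M]
    [TopologicalSpace N] [ChartedSpace (R2 n) N] (f : M → N) (σ : TwoForm n N) : TwoForm n M :=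
  fun p => (σ (f p)).compContinuousLinearMap (mfderiv (𝓡 (2 * n)) (𝓡 (2 * n)) f p)

/-- The expression `(e⁻¹)^* σ` of a two-form in a chart `e`; it is meaningful on `e.target`. -/
def inChart {n : ℕ} {M : Type*} [TopologicalSpace M] [ChartedSpace (R2 n) M]
    (σ : TwoForm n M) (e : OpenPartialHomeomorph M (R2 n)) : R2 n → R2 n [⋀^Fin 2]→L[ℝ] ℝ :=
  fun y => pullback (n := n) (e.symm : R2 n → M) σ y

/-- A symplectic form: a smooth, closed, non-degenerate two-form. Smoothness and `dσ = 0` are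
expressed in the charts of the atlas. -/
structure IsSymplectic {n : ℕ} {M : Type*} [TopologicalSpace M] [ChartedSpace (R2 n) M]
    (σ : TwoForm n M) : Prop where
  smooth : ∀ e ∈ atlas (R2 n) M, ContDiffOn ℝ ∞ (inChart σ e) e.target
  closed : ∀ e ∈ atlas (R2 n) M, ∀ y ∈ e.target, extDeriv (inChart σ e) y = 0
  nondegenerate : ∀ (p : M) (v : TangentSpace (𝓡 (2 * n)) p),
    (∀ w : TangentSpace (𝓡 (2 * n)) p, σ p ![v, w] = 0) → v = 0

/-! ### Hamiltonian vector fields and Poisson brackets -/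

/-- The differential of a real function at a point, as a covector. -/
def differential {n : ℕ} {M : Type*} [TopologicalSpace M] [ChartedSpace (R2 n) M]
    (f : M → ℝ) (p : M) : TangentSpace (𝓡 (2 * n)) p →L[ℝ] ℝ :=
  mfderiv (𝓡 (2 * n)) 𝓘(ℝ, ℝ) f p

open scoped Classical in
/-- The Hamiltonian vector field `X_f`, determined by `σ(X_f, ·) = -df`
(see `hamiltonianVectorField_spec`). -/
def hamiltonianVectorField {n : ℕ} {M : Type*} [TopologicalSpace M] [ChartedSpace (R2 n) M]
    (σ : TwoForm n M) (f : M → ℝ) (p : M) : TangentSpace (𝓡 (2 * n)) p :=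
  if h : ∃ X : TangentSpace (𝓡 (2 * n)) p,
      ∀ v : TangentSpace (𝓡 (2 * n)) p, σ p ![X, v] = -differential (n := n) f p v
  then h.choose else 0

/-- The Poisson bracket `{f, g} = σ(X_f, X_g)`. -/
def poissonBracket {n : ℕ} {M : Type*} [TopologicalSpace M] [ChartedSpace (R2 n) M]
    (σ : TwoForm n M) (f g : M → ℝ) : M → ℝ :=
  fun p => σ p ![hamiltonianVectorField σ f p, hamiltonianVectorField σ g p]

/-- For a non-degenerate form on a finite-dimensional space, every covector is `σ(X, ·)`. -/
theorem exists_contract_eq {V : Type*} [AddCommGroup V] [Module ℝ V] [TopologicalSpace V]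
    [FiniteDimensional ℝ V] (σ : V [⋀^Fin 2]→L[ℝ] ℝ)
    (hσ : ∀ v : V, (∀ w : V, σ ![v, w] = 0) → v = 0) (α : V →ₗ[ℝ] ℝ) :
    ∃ X : V, ∀ v : V, σ ![X, v] = α v := by
  have e0 : ∀ a w x : V, Function.update ![a, w] 0 x = ![x, w] := fun a w x => by
    ext i; fin_cases i <;> simp
  have e1 : ∀ a w x : V, Function.update ![a, w] 1 x = ![a, x] := fun a w x => by
    ext i; fin_cases i <;> simp
  have hadd0 : ∀ a b w : V, σ ![a + b, w] = σ ![a, w] + σ ![b, w] := fun a b w => by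
    have h := σ.map_update_add ![a, w] 0 a b
    rwa [e0, e0, e0] at h
  have hsmul0 : ∀ (c : ℝ) (a w : V), σ ![c • a, w] = c • σ ![a, w] := fun c a w => by
    have h := σ.map_update_smul ![a, w] 0 c a
    rwa [e0, e0] at h
  have hadd1 : ∀ v a b : V, σ ![v, a + b] = σ ![v, a] + σ ![v, b] := fun v a b => by
    have h := σ.map_update_add ![v, a] 1 a b
    rwa [e1, e1, e1] at h
  have hsmul1 : ∀ (c : ℝ) (v a : V), σ ![v, c • a] = c • σ ![v, a] := fun c v a => by
    have h := σ.map_update_smul ![v, a] 1 c a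
    rwa [e1, e1] at h
  let B : V →ₗ[ℝ] V →ₗ[ℝ] ℝ :=
    LinearMap.mk₂ ℝ (fun v w => σ ![v, w]) hadd0 hsmul0 hadd1 hsmul1
  have hinj : Function.Injective B := by
    rw [← LinearMap.ker_eq_bot, LinearMap.ker_eq_bot']
    intro v hv
    exact hσ v fun w => congrArg (fun l : V →ₗ[ℝ] ℝ => l w) hv
  have hsurj : Function.Surjective B :=
    (LinearMap.injective_iff_surjective_of_finrank_eq_finrank
      (Subspace.dual_finrank_eq (K := ℝ) (V := V)).symm).1 hinj
  obtain ⟨X, hX⟩ := hsurj α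
  exact ⟨X, fun v => congrArg (fun l : V →ₗ[ℝ] ℝ => l v) hX⟩

/-- The defining equation of the Hamiltonian vector field. -/
theorem hamiltonianVectorField_spec {n : ℕ} {M : Type*} [TopologicalSpace M]
    [ChartedSpace (R2 n) M] {σ : TwoForm n M} (hσ : IsSymplectic σ) (f : M → ℝ) (p : M)
    (v : TangentSpace (𝓡 (2 * n)) p) :
    σ p ![hamiltonianVectorField σ f p, v] = -differential (n := n) f p v := by
  have : FiniteDimensional ℝ (TangentSpace (𝓡 (2 * n)) p) :=
    inferInstanceAs (FiniteDimensional ℝ (R2 n))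
  have h : ∃ X : TangentSpace (𝓡 (2 * n)) p,
      ∀ v : TangentSpace (𝓡 (2 * n)) p, σ p ![X, v] = -differential (n := n) f p v :=
    exists_contract_eq (σ p) (hσ.nondegenerate p)
      (-(differential (n := n) f p : TangentSpace (𝓡 (2 * n)) p →ₗ[ℝ] ℝ))
  rw [hamiltonianVectorField, dif_pos h]
  exact h.choose_spec v

/-! ### Integrable systems -/

/-- A point is regular for `F` when the differential of `F` there is onto `ℝⁿ`, i.e. has rank
`n`. -/
def IsRegularPoint {n : ℕ} {M : Type*} [TopologicalSpace M] [ChartedSpace (R2 n) M]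
    (F : M → R1 n) (p : M) : Prop :=
  Surjective (mfderiv (𝓡 (2 * n)) (𝓡 n) F p)

/-- `(M, σ, F)` is an integrable system with `n` degrees of freedom. "Almost everywhere" refers
to the Lebesgue measure class of the charts. -/
structure IsIntegrableSystem {n : ℕ} {M : Type*} [TopologicalSpace M] [ChartedSpace (R2 n) M]
    (σ : TwoForm n M) (F : M → R1 n) : Prop where
  symplectic : IsSymplectic σ
  smooth : ContMDiff (𝓡 (2 * n)) (𝓡 n) ∞ F
  involution : ∀ (i j : Fin n) (p : M),
    poissonBracket σ (fun q => F q i) (fun q => F q j) p = 0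
  independent : ∀ e ∈ atlas (R2 n) M,
    volume (e '' (e.source ∩ {p | ¬ IsRegularPoint F p})) = 0

/-- The restriction `σ|_U` to an open subset. -/
def restrictForm {n : ℕ} {M : Type*} [TopologicalSpace M] [ChartedSpace (R2 n) M]
    (σ : TwoForm n M) (U : Opens M) : TwoForm n U :=
  pullback (Subtype.val : U → M) σ

/-- The restriction `F|_U` to an open subset. -/
def restrictMap {n : ℕ} {M : Type*} [TopologicalSpace M] (F : M → R1 n) (U : Opens M) :
    U → R1 n :=
  fun p => F p

/-- Smoothness of a map defined on an arbitrary subset `A ⊆ ℝⁿ`: local smooth extendability. -/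
def IsSmoothOnSubset {n : ℕ} {A : Set (R1 n)} (h : A → R1 n) : Prop :=
  ∀ a : A, ∃ (W : Set (R1 n)) (k : R1 n → R1 n),
    IsOpen W ∧ (a : R1 n) ∈ W ∧ ContDiffOn ℝ ∞ k W ∧ ∀ b : A, (b : R1 n) ∈ W → k b = h b

/-- The pair `(φ, g)` is a strong symplectic equivalence from `(M, σ, F)` to `(N, η, G)`:
`φ` is a symplectomorphism, `g : F(M) → G(N)` is a diffeomorphism, and `G ∘ φ = g ∘ F`. -/
structure IsStrongSymplecticEquivalence {n : ℕ} {M N : Type*}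
    [TopologicalSpace M] [ChartedSpace (R2 n) M] [TopologicalSpace N] [ChartedSpace (R2 n) N]
    (σ : TwoForm n M) (F : M → R1 n) (η : TwoForm n N) (G : N → R1 n)
    (φ : M ≃ₘ^∞⟮𝓡 (2 * n), 𝓡 (2 * n)⟯ N) (g : range F ≃ range G) : Prop where
  symplectomorphism : pullback (n := n) φ η = σ
  smooth : IsSmoothOnSubset (fun a => (g a : R1 n))
  smooth_symm : IsSmoothOnSubset (fun b => (g.symm b : R1 n))
  commutes : ∀ p : M, G (φ p) = g ⟨F p, mem_range_self p⟩

/-! ### The standard system on `ℝ²ⁿ`, and Darboux coordinates -/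

/-- The position of the coordinate `x_i` among the coordinates `(x_1, …, x_n, ξ_1, …, ξ_n)`. -/
def xIndex {n : ℕ} (i : Fin n) : Fin (2 * n) := ⟨i, by omega⟩

/-- The position of the coordinate `ξ_i` among the coordinates `(x_1, …, x_n, ξ_1, …, ξ_n)`. -/
def xiIndex {n : ℕ} (i : Fin n) : Fin (2 * n) := ⟨n + i, by omega⟩

/-- The canonical symplectic form `σ_can = ∑ i, dξ_i ∧ dx_i` on `ℝ²ⁿ`. -/
def canonicalForm (n : ℕ) : TwoForm n (R2 n) :=
  fun p => ∑ i : Fin n,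
    wedge (differential (n := n) (fun q : R2 n => q (xiIndex i)) p)
      (differential (n := n) (fun q : R2 n => q (xIndex i)) p)

/-- The map `ξ = (ξ_1, …, ξ_n) : ℝ²ⁿ → ℝⁿ`. -/
def xiMap (n : ℕ) : R2 n → R1 n :=
  fun q => WithLp.toLp 2 fun i => q (xiIndex i)

/-- The functions `(x_1, …, x_n, ξ_1, …, ξ_n)` restrict to Darboux coordinates on the open
neighbourhood `U` of `m`, centred at `m`: they are the components of a smooth chart with domain
`U` that maps `m` to the origin, and `σ = ∑ i, dξ_i ∧ dx_i` on `U`. -/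
def IsDarbouxCoordinates {n : ℕ} {M : Type*} [TopologicalSpace M] [ChartedSpace (R2 n) M]
    (σ : TwoForm n M) (m : M) (U : Opens M) (x ξ : Fin n → M → ℝ) : Prop :=
  m ∈ U ∧
  (∃ e ∈ IsManifold.maximalAtlas (𝓡 (2 * n)) ∞ M, e.source = (U : Set M) ∧ e m = 0 ∧
    ∀ p ∈ U, ∀ i : Fin n, e p (xIndex i) = x i p ∧ e p (xiIndex i) = ξ i p) ∧
  ∀ p ∈ U, σ p = ∑ i : Fin n,
    wedge (differential (n := n) (ξ i) p) (differential (n := n) (x i) p)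

end DarbouxCaratheodory

end

/-!
Near a regular point, involution says that the fibres of `F` are Lagrangian. In a chart that
straightens `F` to a linear projection, the homotopy operator along the fibres gives a primitive of
`σ` that vanishes on vectors tangent to the fibres; such a primitive has the form
`-∑ i, x_i df_i`, so `σ = ∑ i, df_i ∧ dx_i`, and nondegeneracy of `σ` makes `(x, F)` a coordinate
system.
-/

noncomputable section

namespace DarbouxCaratheodory

theorem hasFDerivAt_of_contDiffOn {E F : Type*} [NormedAddCommGroup E] [NormedSpace ℝ E]
    [NormedAddCommGroup F] [NormedSpace ℝ F] {g : E → F} {W : Set E} (hW : IsOpen W)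
    (hg : ContDiffOn ℝ ∞ g W) {y : E} (hy : y ∈ W) : HasFDerivAt g (fderiv ℝ g y) y :=
  ((hg.differentiableOn (by simp)).differentiableAt (hW.mem_nhds hy)).hasFDerivAt

/-! ### Integrals depending on a parameter -/

section ParametricIntegral

universe u

theorem hasFDerivAt_fderiv_comp_inl {E F : Type*} [NormedAddCommGroup E] [NormedSpace ℝ E]
    [NormedAddCommGroup F] [NormedSpace ℝ F] {g : E × ℝ → F} {O : Set (E × ℝ)} (hO : IsOpen O)
    (hg : ContDiffOn ℝ 1 g O) {x : E} {t : ℝ} (hxt : (x, t) ∈ O) :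
    HasFDerivAt (fun z => g (z, t)) ((fderiv ℝ g (x, t)).comp (.inl ℝ E ℝ)) x :=
  ((hg.differentiableOn one_ne_zero).differentiableAt (hO.mem_nhds hxt)).hasFDerivAt.comp x
    (hasFDerivAt_prodMk_left x t)

theorem hasFDerivAt_intervalIntegral_of_contDiffOn {E F : Type*} [NormedAddCommGroup E]
    [NormedSpace ℝ E] [NormedAddCommGroup F] [NormedSpace ℝ F] {g : E × ℝ → F} {O : Set (E × ℝ)}
    (hO : IsOpen O) (hg : ContDiffOn ℝ 1 g O) {a b : ℝ} {x₀ : E}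
    (hx₀ : ∀ t ∈ uIcc a b, (x₀, t) ∈ O) :
    HasFDerivAt (fun x => ∫ t in a..b, g (x, t))
      (∫ t in a..b, (fderiv ℝ g (x₀, t)).comp (.inl ℝ E ℝ)) x₀ := by
  set D : E × ℝ → E →L[ℝ] F := fun q => (fderiv ℝ g q).comp (.inl ℝ E ℝ)
  have hD : ContinuousOn D O :=
    (hg.continuousOn_fderiv_of_isOpen hO le_rfl).clm_comp continuousOn_const
  obtain ⟨C, hC⟩ := isCompact_uIcc.bddAbove_image (hD.comp (by fun_prop) hx₀).norm
  have hbound : ∀ᶠ x in nhds x₀, ∀ t ∈ uIcc a b, (x, t) ∈ O ∧ ‖D (x, t)‖ < C + 1 := by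
    refine isCompact_uIcc.eventually_forall_of_forall_eventually fun t ht => ?_
    have hlt : ‖D (x₀, t)‖ < C + 1 := (hC (mem_image_of_mem _ ht)).trans_lt (lt_add_one C)
    exact (hO.eventually_mem (hx₀ t ht)).and
      ((hD.continuousAt (hO.mem_nhds (hx₀ t ht))).norm.eventually_lt_const hlt)
  have hslice : ∀ {x}, (∀ t ∈ uIcc a b, (x, t) ∈ O) →
      ContinuousOn (fun t => g (x, t)) (uIcc a b) := fun hx =>
    hg.continuousOn.comp (by fun_prop) hx
  refine intervalIntegral.hasFDerivAt_integral_of_dominated_of_fderiv_le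
    (F := fun x t => g (x, t)) (F' := fun x t => D (x, t)) (bound := fun _ => C + 1)
    hbound ?_ (hslice hx₀).intervalIntegrable ?_ ?_ intervalIntegrable_const ?_
  · filter_upwards [hbound] with x hx
    exact ((hslice fun t ht => (hx t ht).1).mono uIoc_subset_uIcc).aestronglyMeasurable
      measurableSet_uIoc
  · exact ((hD.comp (by fun_prop) hx₀).mono uIoc_subset_uIcc).aestronglyMeasurable
      measurableSet_uIoc
  · exact .of_forall fun t ht x hx => (hx t (uIoc_subset_uIcc ht)).2.le
  · exact .of_forall fun t ht x hx =>
      hasFDerivAt_fderiv_comp_inl hO hg (hx t (uIoc_subset_uIcc ht)).1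

-- The induction replaces `F` by `E →L[ℝ] F`, so the two spaces live in one universe.
theorem contDiffOn_intervalIntegral {E : Type u} [NormedAddCommGroup E] [NormedSpace ℝ E]
    {O : Set (E × ℝ)} (hO : IsOpen O) {W : Set E} (hW : IsOpen W) {a b : ℝ}
    (hWO : ∀ x ∈ W, ∀ t ∈ uIcc a b, (x, t) ∈ O) {F : Type u} [NormedAddCommGroup F]
    [NormedSpace ℝ F] {g : E × ℝ → F} (hg : ContDiffOn ℝ ∞ g O) :
    ContDiffOn ℝ ∞ (fun x => ∫ t in a..b, g (x, t)) W := by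
  refine contDiffOn_infty.2 fun k => ?_
  induction k generalizing F with
  | zero =>
    exact contDiffOn_zero.2 fun x hx => (hasFDerivAt_intervalIntegral_of_contDiffOn hO
      (hg.of_le (by simp)) (hWO x hx)).continuousAt.continuousWithinAt
  | succ k ih =>
    have hderiv := fun x hx => hasFDerivAt_intervalIntegral_of_contDiffOn hO
      (hg.of_le (by simp)) (hWO x hx)
    rw [Nat.cast_succ, contDiffOn_succ_iff_fderiv_of_isOpen hW]
    refine ⟨fun x hx => (hderiv x hx).differentiableAt.differentiableWithinAt, by simp, ?_⟩
    exact (ih ((hg.fderiv_of_isOpen hO (by simp)).clm_comp contDiffOn_const)).congr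
      fun x hx => (hderiv x hx).fderiv

end ParametricIntegral

/-! ### The homotopy operator on two-forms -/

section HomotopyOperator

universe u

variable {E : Type u} [NormedAddCommGroup E] [NormedSpace ℝ E]

theorem map_pair_swap {V : Type*} [AddCommGroup V] [Module ℝ V] [TopologicalSpace V]
    (τ : V [⋀^Fin 2]→L[ℝ] ℝ) (a b : V) : τ ![a, b] = -τ ![b, a] := by
  have h := τ.map_swap ![b, a] (i := 0) (j := 1) (by decide)
  have hswap : ![b, a] ∘ Equiv.swap (0 : Fin 2) 1 = ![a, b] := by
    ext i; fin_cases i <;> simp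
  rwa [hswap] at h

theorem compContinuousLinearMap_pair {V V' : Type*} [AddCommGroup V] [Module ℝ V]
    [TopologicalSpace V] [AddCommGroup V'] [Module ℝ V'] [TopologicalSpace V']
    (τ : V' [⋀^Fin 2]→L[ℝ] ℝ) (A : V →L[ℝ] V') (a b : V) :
    τ.compContinuousLinearMap A ![a, b] = τ ![A a, A b] := by
  rw [ContinuousAlternatingMap.compContinuousLinearMap_apply]
  congr 1
  ext i; fin_cases i <;> rfl

variable (E) in
/-- The continuous bilinear map `(a, b) ↦ τ(a, b)` of an alternating two-form `τ`. -/
def bilinOfForm : (E [⋀^Fin 2]→L[ℝ] ℝ) →L[ℝ] E →L[ℝ] E →L[ℝ] ℝ :=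
  ((ContinuousAlternatingMap.ofSubsingletonLIE (𝕜 := ℝ) (E := E) (F := ℝ)
    (0 : Fin 1)).symm.toContinuousLinearEquiv.toContinuousLinearMap.postcomp E).comp
  (ContinuousAlternatingMap.curryLeftLI (𝕜 := ℝ) (E := E) (F := ℝ)
    (n := 1)).toContinuousLinearMap

@[simp]
theorem bilinOfForm_apply (τ : E [⋀^Fin 2]→L[ℝ] ℝ) (a b : E) :
    bilinOfForm E τ a b = τ ![a, b] := by
  have hpair : (Matrix.vecCons a fun _ : Fin 1 => b) = ![a, b] := by
    ext i; fin_cases i <;> rfl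
  simp [bilinOfForm, hpair]

theorem fderiv_apply_cyclic_of_extDeriv_eq_zero {τ : E → E [⋀^Fin 2]→L[ℝ] ℝ} {x : E}
    (hclosed : extDeriv τ x = 0) (u v w : E) :
    fderiv ℝ τ x u ![v, w] = fderiv ℝ τ x v ![u, w] - fderiv ℝ τ x w ![u, v] := by
  have h0 : Fin.removeNth 0 ![u, v, w] = ![v, w] := by ext i; fin_cases i <;> rfl
  have h1 : Fin.removeNth 1 ![u, v, w] = ![u, w] := by ext i; fin_cases i <;> rfl
  have h2 : Fin.removeNth 2 ![u, v, w] = ![u, v] := by ext i; fin_cases i <;> rfl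
  have hsum : fderiv ℝ τ x u ![v, w] + -fderiv ℝ τ x v ![u, w] + fderiv ℝ τ x w ![u, v] = 0 := by
    simpa [extDeriv, ContinuousAlternatingMap.alternatizeUncurryFin_apply, Fin.sum_univ_three,
      h0, h1, h2] using congr($hclosed ![u, v, w])
  linarith

theorem hasFDerivAt_bilinOfForm (τ : E [⋀^Fin 2]→L[ℝ] ℝ) :
    HasFDerivAt (fun η => bilinOfForm E η) (bilinOfForm E) τ :=
  ContinuousLinearMap.hasFDerivAt _

theorem contDiff_bilinOfForm : ContDiff ℝ ∞ fun η : E [⋀^Fin 2]→L[ℝ] ℝ => bilinOfForm E η :=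
  ContinuousLinearMap.contDiff _

theorem hasDerivAt_apply_pair {T : ℝ → E [⋀^Fin 2]→L[ℝ] ℝ} {T' : E [⋀^Fin 2]→L[ℝ] ℝ}
    {v w : ℝ → E} {v' w' : E} {t : ℝ} (hT : HasDerivAt T T' t) (hv : HasDerivAt v v' t)
    (hw : HasDerivAt w w' t) :
    HasDerivAt (fun s => T s ![v s, w s])
      (T' ![v t, w t] + T t ![v', w t] + T t ![v t, w']) t := by
  have hbilin : HasDerivAt (fun s => bilinOfForm E (T s)) (bilinOfForm E T') t :=
    HasFDerivAt.comp_hasDerivAt (l := fun η => bilinOfForm E η) t (hasFDerivAt_bilinOfForm (T t)) hT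
  simpa only [add_apply, bilinOfForm_apply] using
    (hbilin.clm_apply hv).clm_apply hw

theorem lineMap_id_apply (Q : E →L[ℝ] E) (t : ℝ) (x : E) :
    AffineMap.lineMap Q (.id ℝ E) t x = AffineMap.lineMap (Q x) x t := by
  simp [AffineMap.lineMap_apply]

theorem hasDerivAt_comp_lineMap {τ : E → E [⋀^Fin 2]→L[ℝ] ℝ} {x y : E} {t : ℝ}
    (hτ : DifferentiableAt ℝ τ (AffineMap.lineMap x y t)) :
    HasDerivAt (fun s : ℝ => τ (AffineMap.lineMap x y s))
      (fderiv ℝ τ (AffineMap.lineMap x y t) (y - x)) t :=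
  hτ.hasFDerivAt.comp_hasDerivAt t AffineMap.hasDerivAt_lineMap

theorem contDiff_lineMap_uncurry (Q : E →L[ℝ] E) :
    ContDiff ℝ ∞ fun q : E × ℝ => AffineMap.lineMap (Q q.1) q.1 q.2 := by
  simp only [AffineMap.lineMap_apply, vsub_eq_sub, vadd_eq_add]
  fun_prop

theorem isOpen_preimage_lineMap (Q : E →L[ℝ] E) {W : Set E} (hW : IsOpen W) :
    IsOpen {q : E × ℝ | AffineMap.lineMap (Q q.1) q.1 q.2 ∈ W} :=
  hW.preimage (contDiff_lineMap_uncurry Q).continuous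

/-- The contraction of the pullback `A_t^* τ`, where `A_t = (1 - t) Q + t id`, with the velocity
`x - Q x` of the homotopy `A`: the one-form to be integrated over `t` in order to obtain a primitive
of `τ - Q^* τ`. -/
def homotopyIntegrand (τ : E → E [⋀^Fin 2]→L[ℝ] ℝ) (Q : E →L[ℝ] E) (q : E × ℝ) : E →L[ℝ] ℝ :=
  (bilinOfForm E (τ (AffineMap.lineMap (Q q.1) q.1 q.2)) (q.1 - Q q.1)).comp
    (AffineMap.lineMap Q (.id ℝ E) q.2)

theorem homotopyIntegrand_apply (τ : E → E [⋀^Fin 2]→L[ℝ] ℝ) (Q : E →L[ℝ] E) (x : E) (t : ℝ)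
    (v : E) :
    homotopyIntegrand τ Q (x, t) v =
      τ (AffineMap.lineMap (Q x) x t) ![x - Q x, AffineMap.lineMap (Q v) v t] := by
  simp only [homotopyIntegrand, ContinuousLinearMap.comp_apply, bilinOfForm_apply,
    lineMap_id_apply]

theorem contDiffOn_homotopyIntegrand {τ : E → E [⋀^Fin 2]→L[ℝ] ℝ} {W : Set E}
    (hτ : ContDiffOn ℝ ∞ τ W) (Q : E →L[ℝ] E) :
    ContDiffOn ℝ ∞ (homotopyIntegrand τ Q) {q | AffineMap.lineMap (Q q.1) q.1 q.2 ∈ W} := by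
  have hform : ContDiffOn ℝ ∞
      (fun q : E × ℝ => bilinOfForm E (τ (AffineMap.lineMap (Q q.1) q.1 q.2)))
      {q | AffineMap.lineMap (Q q.1) q.1 q.2 ∈ W} :=
    contDiff_bilinOfForm.comp_contDiffOn
      (hτ.comp (contDiff_lineMap_uncurry Q).contDiffOn fun q hq => hq)
  have hvelocity : ContDiff ℝ ∞ fun q : E × ℝ => q.1 - Q q.1 := by fun_prop
  have hA : ContDiff ℝ ∞ fun q : E × ℝ => (AffineMap.lineMap Q (.id ℝ E) q.2 : E →L[ℝ] E) := by
    simp only [AffineMap.lineMap_apply, vsub_eq_sub, vadd_eq_add]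
    fun_prop
  exact (hform.clm_apply hvelocity.contDiffOn).clm_comp hA.contDiffOn

theorem fderiv_homotopyIntegrand_apply {τ : E → E [⋀^Fin 2]→L[ℝ] ℝ} {W : Set E} (hW : IsOpen W)
    (hτ : ContDiffOn ℝ ∞ τ W) {Q : E →L[ℝ] E} {x : E} {t : ℝ}
    (hxt : AffineMap.lineMap (Q x) x t ∈ W) (v w : E) :
    fderiv ℝ (homotopyIntegrand τ Q) (x, t) (v, 0) w =
      fderiv ℝ τ (AffineMap.lineMap (Q x) x t) (AffineMap.lineMap (Q v) v t)
          ![x - Q x, AffineMap.lineMap (Q w) w t] +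
        τ (AffineMap.lineMap (Q x) x t) ![v - Q v, AffineMap.lineMap (Q w) w t] := by
  set A : E →L[ℝ] E := AffineMap.lineMap Q (.id ℝ E) t
  have hA : ∀ z, AffineMap.lineMap (Q z) z t = A z := fun z => (lineMap_id_apply Q t z).symm
  have hline : ∀ B : E →L[ℝ] E, HasDerivAt (fun s : ℝ => B (x + s • v)) (B v) 0 := fun B =>
    B.hasFDerivAt.hasLineDerivAt v
  have hleft : HasLineDerivAt ℝ (fun z => homotopyIntegrand τ Q (z, t) w)
      (fderiv ℝ (homotopyIntegrand τ Q) (x, t) (v, 0) w) x v := by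
    have hfderiv := hasFDerivAt_fderiv_comp_inl (isOpen_preimage_lineMap Q hW)
      ((contDiffOn_homotopyIntegrand hτ Q).of_le (by simp)) hxt
    simpa using (hfderiv.clm_apply (hasFDerivAt_const w x)).hasLineDerivAt v
  have hform : HasDerivAt (fun s : ℝ => τ (A (x + s • v))) (fderiv ℝ τ (A x) (A v)) 0 := by
    have hτ_diff : DifferentiableAt ℝ τ (A x) :=
      (hasFDerivAt_of_contDiffOn hW hτ (hA x ▸ hxt)).differentiableAt
    exact (hτ_diff.hasFDerivAt.comp x A.hasFDerivAt).hasLineDerivAt v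
  have hright : HasLineDerivAt ℝ (fun z => homotopyIntegrand τ Q (z, t) w)
      (fderiv ℝ τ (A x) (A v) ![x - Q x, A w] + τ (A x) ![v - Q v, A w]) x v := by
    have h := hasDerivAt_apply_pair hform (hline (.id ℝ E - Q)) (hasDerivAt_const 0 (A w))
    have hzero : ∀ a, τ (A x) ![a, 0] = 0 := fun a => (τ (A x)).map_coord_zero 1 rfl
    simpa only [HasLineDerivAt, homotopyIntegrand_apply, hA, hzero, add_zero, zero_smul, sub_apply,
      ContinuousLinearMap.id_apply] using h
  simpa only [hA] using hleft.unique hright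

/-- Cartan's formula `d/dt (A_t^* τ) = d (ι A_t^* τ)` for a closed form `τ`. -/
theorem hasDerivAt_pullback_lineMap {τ : E → E [⋀^Fin 2]→L[ℝ] ℝ} {W : Set E} (hW : IsOpen W)
    (hτ : ContDiffOn ℝ ∞ τ W) (hclosed : ∀ x ∈ W, extDeriv τ x = 0) {Q : E →L[ℝ] E} {x : E} {t : ℝ}
    (hxt : AffineMap.lineMap (Q x) x t ∈ W) (a b : E) :
    HasDerivAt (fun s : ℝ => τ (AffineMap.lineMap (Q x) x s)
        ![AffineMap.lineMap (Q a) a s, AffineMap.lineMap (Q b) b s])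
      (fderiv ℝ (homotopyIntegrand τ Q) (x, t) (a, 0) b -
        fderiv ℝ (homotopyIntegrand τ Q) (x, t) (b, 0) a) t := by
  have hτ_diff : DifferentiableAt ℝ τ (AffineMap.lineMap (Q x) x t) :=
    (hasFDerivAt_of_contDiffOn hW hτ hxt).differentiableAt
  refine (hasDerivAt_apply_pair (hasDerivAt_comp_lineMap hτ_diff) AffineMap.hasDerivAt_lineMap
    AffineMap.hasDerivAt_lineMap).congr_deriv ?_
  rw [fderiv_homotopyIntegrand_apply hW hτ hxt, fderiv_homotopyIntegrand_apply hW hτ hxt,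
    fderiv_apply_cyclic_of_extDeriv_eq_zero (hclosed _ hxt),
    map_pair_swap _ (AffineMap.lineMap (Q a) a t) (b - Q b)]
  ring

/-- The one-form `∫₀¹ ι A_t^* τ dt`, where `A_t = (1 - t) Q + t id`: a primitive of `τ - Q^* τ`
when `τ` is closed. -/
def homotopyOperator (τ : E → E [⋀^Fin 2]→L[ℝ] ℝ) (Q : E →L[ℝ] E) (x : E) : E →L[ℝ] ℝ :=
  ∫ t in (0 : ℝ)..1, homotopyIntegrand τ Q (x, t)

theorem lineMap_mem_of_mapsTo {W : Set E} (hconv : Convex ℝ W) {Q : E →L[ℝ] E} (hQ : MapsTo Q W W)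
    {x : E} (hx : x ∈ W) {t : ℝ} (ht : t ∈ uIcc (0 : ℝ) 1) : AffineMap.lineMap (Q x) x t ∈ W :=
  hconv.lineMap_mem (hQ hx) hx (uIcc_of_le (zero_le_one' ℝ) ▸ ht)

section

variable {τ : E → E [⋀^Fin 2]→L[ℝ] ℝ} {W : Set E} (hconv : Convex ℝ W) (hτ : ContDiffOn ℝ ∞ τ W)
  {Q : E →L[ℝ] E} (hQ : MapsTo Q W W)

include hconv hτ hQ

theorem homotopyOperator_apply {x : E} (hx : x ∈ W) (v : E) :
    homotopyOperator τ Q x v = ∫ t in (0 : ℝ)..1,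
      τ (AffineMap.lineMap (Q x) x t) ![x - Q x, AffineMap.lineMap (Q v) v t] := by
  have hint : IntervalIntegrable (fun t => homotopyIntegrand τ Q (x, t)) volume 0 1 :=
    ((contDiffOn_homotopyIntegrand hτ Q).continuousOn.comp (by fun_prop)
      fun _ ht => lineMap_mem_of_mapsTo hconv hQ hx ht).intervalIntegrable
  rw [homotopyOperator, ContinuousLinearMap.intervalIntegral_apply hint]
  simp only [homotopyIntegrand_apply]

variable (hW : IsOpen W)

include hW

theorem contDiffOn_homotopyOperator : ContDiffOn ℝ ∞ (homotopyOperator τ Q) W :=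
  contDiffOn_intervalIntegral (isOpen_preimage_lineMap Q hW) hW
    (fun _ hx _ ht => lineMap_mem_of_mapsTo hconv hQ hx ht) (contDiffOn_homotopyIntegrand hτ Q)

theorem continuousOn_fderiv_homotopyIntegrand {x : E} (hx : x ∈ W) :
    ContinuousOn (fun t => (fderiv ℝ (homotopyIntegrand τ Q) (x, t)).comp (.inl ℝ E ℝ))
      (uIcc 0 1) := by
  have hfderiv := (contDiffOn_homotopyIntegrand hτ Q).continuousOn_fderiv_of_isOpen
    (isOpen_preimage_lineMap Q hW) (by simp)
  have hline : MapsTo (fun t : ℝ => (x, t)) (uIcc 0 1)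
      {q | AffineMap.lineMap (Q q.1) q.1 q.2 ∈ W} :=
    fun _ ht => lineMap_mem_of_mapsTo hconv hQ hx ht
  exact (hfderiv.comp (by fun_prop) hline).clm_comp continuousOn_const

theorem fderiv_homotopyOperator_apply {x : E} (hx : x ∈ W) (v w : E) :
    fderiv ℝ (homotopyOperator τ Q) x v w =
      ∫ t in (0 : ℝ)..1, fderiv ℝ (homotopyIntegrand τ Q) (x, t) (v, 0) w := by
  have hcont := continuousOn_fderiv_homotopyIntegrand hconv hτ hQ hW hx
  have hfderiv : fderiv ℝ (homotopyOperator τ Q) x =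
      ∫ t in (0 : ℝ)..1, (fderiv ℝ (homotopyIntegrand τ Q) (x, t)).comp (.inl ℝ E ℝ) :=
    (hasFDerivAt_intervalIntegral_of_contDiffOn (isOpen_preimage_lineMap Q hW)
      ((contDiffOn_homotopyIntegrand hτ Q).of_le (by simp))
      fun _ ht => lineMap_mem_of_mapsTo hconv hQ hx ht).fderiv
  rw [hfderiv, ContinuousLinearMap.intervalIntegral_apply hcont.intervalIntegrable,
    ContinuousLinearMap.intervalIntegral_apply
      (hcont.clm_apply continuousOn_const).intervalIntegrable]
  rfl

theorem fderiv_homotopyOperator_sub (hclosed : ∀ x ∈ W, extDeriv τ x = 0) {x : E} (hx : x ∈ W)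
    (a b : E) :
    fderiv ℝ (homotopyOperator τ Q) x a b - fderiv ℝ (homotopyOperator τ Q) x b a =
      τ x ![a, b] - τ (Q x) ![Q a, Q b] := by
  have hint : ∀ v w, IntervalIntegrable
      (fun t => fderiv ℝ (homotopyIntegrand τ Q) (x, t) (v, 0) w) volume 0 1 := fun v w =>
    (((continuousOn_fderiv_homotopyIntegrand hconv hτ hQ hW hx).clm_apply
      continuousOn_const).clm_apply continuousOn_const).intervalIntegrable
  rw [fderiv_homotopyOperator_apply hconv hτ hQ hW hx,
    fderiv_homotopyOperator_apply hconv hτ hQ hW hx,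
    ← intervalIntegral.integral_sub (hint a b) (hint b a),
    intervalIntegral.integral_eq_sub_of_hasDerivAt
      (fun t ht => hasDerivAt_pullback_lineMap hW hτ hclosed
        (lineMap_mem_of_mapsTo hconv hQ hx ht) a b)
      ((hint a b).sub (hint b a))]
  simp only [AffineMap.lineMap_apply_one, AffineMap.lineMap_apply_zero]

end
end HomotopyOperator

/-! ### Primitives vanishing along an isotropic foliation -/

section RelativePoincare

variable {E : Type*} [NormedAddCommGroup E] [NormedSpace ℝ E]

/-- Relative Poincaré lemma: the primitive is the sum of the homotopy operator from `id` to the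
projection `Q` and the pullback by `Q` of the homotopy operator from `id` to `0`. -/
theorem exists_primitive_of_isotropic_ker {τ : E → E [⋀^Fin 2]→L[ℝ] ℝ} {W : Set E}
    (hconv : Convex ℝ W) (hW : IsOpen W) (h0 : (0 : E) ∈ W) (hτ : ContDiffOn ℝ ∞ τ W)
    (hclosed : ∀ x ∈ W, extDeriv τ x = 0) {Q : E →L[ℝ] E} (hidem : ∀ v, Q (Q v) = Q v)
    (hQ : MapsTo Q W W) (hiso : ∀ x ∈ W, ∀ a b, Q a = 0 → Q b = 0 → τ x ![a, b] = 0) :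
    ∃ β : E → E →L[ℝ] ℝ, ContDiffOn ℝ ∞ β W ∧
      (∀ x ∈ W, ∀ a b, fderiv ℝ β x a b - fderiv ℝ β x b a = τ x ![a, b]) ∧
      ∀ x ∈ W, ∀ v, Q v = 0 → β x v = 0 := by
  have hzero : MapsTo (0 : E →L[ℝ] E) W W := fun _ _ => h0
  have hθ : ContDiffOn ℝ ∞ (homotopyOperator τ Q) W :=
    contDiffOn_homotopyOperator hconv hτ hQ hW
  have hθ₀ : ContDiffOn ℝ ∞ (homotopyOperator τ 0) W :=
    contDiffOn_homotopyOperator hconv hτ hzero hW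
  refine ⟨fun x => homotopyOperator τ Q x + (homotopyOperator τ 0 (Q x)).comp Q,
    hθ.add ((hθ₀.comp Q.contDiff.contDiffOn hQ).clm_comp contDiffOn_const), ?_, ?_⟩
  · intro x hx a b
    have hθ_deriv := hasFDerivAt_of_contDiffOn hW hθ hx
    have hpull : HasFDerivAt (fun z => homotopyOperator τ 0 (Q z)) _ x :=
      (hasFDerivAt_of_contDiffOn hW hθ₀ (hQ hx)).comp x Q.hasFDerivAt
    have hsum := (hθ_deriv.fun_add (hpull.clm_comp (hasFDerivAt_const Q x))).fderiv
    have hd := fderiv_homotopyOperator_sub hconv hτ hQ hW hclosed hx a b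
    have hd₀ := fderiv_homotopyOperator_sub hconv hτ hzero hW hclosed (hQ hx) (Q a) (Q b)
    have hzero_apply : τ 0 ![0, 0] = 0 := (τ 0).map_coord_zero 0 rfl
    simp only [zero_apply, hzero_apply, sub_zero] at hd₀
    rw [hsum]
    simp only [ContinuousLinearMap.comp_zero, zero_add, add_apply,
      ContinuousLinearMap.comp_apply, ContinuousLinearMap.flip_apply,
      ContinuousLinearMap.compL_apply]
    linarith
  · intro x hx v hv
    have hintegrand : ∀ t ∈ uIcc (0 : ℝ) 1,
        τ (AffineMap.lineMap (Q x) x t) ![x - Q x, AffineMap.lineMap (Q v) v t] = 0 :=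
      fun t ht => hiso _ (lineMap_mem_of_mapsTo hconv hQ hx ht) _ _
        (by rw [map_sub, hidem, sub_self]) (by simp [hv, AffineMap.lineMap_apply])
    simp only [add_apply, ContinuousLinearMap.comp_apply, hv, map_zero, add_zero]
    rw [homotopyOperator_apply hconv hτ hQ hx, intervalIntegral.integral_congr hintegrand,
      intervalIntegral.integral_zero]

variable {F : Type*} [NormedAddCommGroup F] [NormedSpace ℝ F]

theorem exists_eq_fderiv_apply_sub_of_isotropic_ker {τ : E → E [⋀^Fin 2]→L[ℝ] ℝ} {W : Set E}
    (hconv : Convex ℝ W) (hW : IsOpen W) (h0 : (0 : E) ∈ W) (hτ : ContDiffOn ℝ ∞ τ W)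
    (hclosed : ∀ x ∈ W, extDeriv τ x = 0) {L : E →L[ℝ] F} {s : F →L[ℝ] E}
    (hLs : ∀ c, L (s c) = c) (hQ : MapsTo (s.comp L) W W)
    (hiso : ∀ x ∈ W, ∀ a b, L a = 0 → L b = 0 → τ x ![a, b] = 0) :
    ∃ η : E → F →L[ℝ] ℝ, ContDiffOn ℝ ∞ η W ∧ η 0 = 0 ∧
      ∀ x ∈ W, ∀ a b, τ x ![a, b] = fderiv ℝ η x b (L a) - fderiv ℝ η x a (L b) := by
  have hker : ∀ v, s.comp L v = 0 → L v = 0 := fun v hv => by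
    simpa [hLs] using congrArg L hv
  obtain ⟨β, hβ, hdβ, hβker⟩ := exists_primitive_of_isotropic_ker hconv hW h0 hτ hclosed
    (Q := s.comp L) (fun v => by simp [hLs]) hQ
    fun x hx a b ha hb => hiso x hx a b (hker a ha) (hker b hb)
  have hβ_deriv : ∀ x ∈ W, HasFDerivAt β (fderiv ℝ β x) x := fun x hx =>
    hasFDerivAt_of_contDiffOn hW hβ hx
  have hβ_eq : ∀ x ∈ W, β x = (β x).comp (s.comp L) := fun x hx => by
    ext v
    have h := hβker x hx (v - s.comp L v) (by simp [hLs])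
    rwa [map_sub, sub_eq_zero] at h
  have hdβ_eq : ∀ x ∈ W, ∀ a b, fderiv ℝ β x a b = fderiv ℝ β x a (s (L b)) := fun x hx a b => by
    have hcomp : HasFDerivAt β _ x := ((hβ_deriv x hx).clm_comp
      (hasFDerivAt_const (s.comp L) x)).congr_of_eventuallyEq
        (Filter.eventually_of_mem (hW.mem_nhds hx) hβ_eq)
    simpa using congr($((hβ_deriv x hx).unique hcomp) a b)
  refine ⟨fun x => (β 0).comp s - (β x).comp s,
    contDiffOn_const.sub (hβ.clm_comp contDiffOn_const), sub_self _, fun x hx a b => ?_⟩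
  have hη := ((hasFDerivAt_const ((β 0).comp s) x).fun_sub
    ((hβ_deriv x hx).clm_comp (hasFDerivAt_const s x))).fderiv
  rw [← hdβ x hx, hdβ_eq x hx, hdβ_eq x hx b, hη]
  simp only [ContinuousLinearMap.comp_zero, zero_add, zero_sub, neg_apply,
    ContinuousLinearMap.comp_apply, ContinuousLinearMap.flip_apply,
    ContinuousLinearMap.compL_apply, sub_neg_eq_add]
  ring

end RelativePoincare

/-! ### Pullbacks of two-forms between normed spaces -/

section Pullback

variable {E F G : Type*} [NormedAddCommGroup E] [NormedSpace ℝ E] [NormedAddCommGroup F]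
  [NormedSpace ℝ F] [NormedAddCommGroup G] [NormedSpace ℝ G]

theorem contDiffOn_of_contDiffOn_bilinOfForm {τ : G → E [⋀^Fin 2]→L[ℝ] ℝ} {W : Set G}
    (hτ : ContDiffOn ℝ ∞ (fun x => bilinOfForm E (τ x)) W) : ContDiffOn ℝ ∞ τ W := by
  let curry : (E →L[ℝ] E →L[ℝ] ℝ) →L[ℝ] E →L[ℝ] E [⋀^Fin 1]→L[ℝ] ℝ :=
    (ContinuousAlternatingMap.ofSubsingletonLIE (𝕜 := ℝ) (E := E) (F := ℝ)
      (0 : Fin 1)).toContinuousLinearEquiv.toContinuousLinearMap.postcomp E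
  have hτ_eq : ∀ x, τ x = (2⁻¹ : ℝ) • ContinuousAlternatingMap.alternatizeUncurryFinCLM ℝ E ℝ
      (curry (bilinOfForm E (τ x))) := fun x => by
    have hcurry : curry (bilinOfForm E (τ x)) = (τ x).curryLeft := by
      ext a v
      simp [curry, bilinOfForm]
    rw [hcurry, ContinuousAlternatingMap.alternatizeUncurryFinCLM_apply,
      ContinuousAlternatingMap.alternatizeUncurryFin_curryLeft, ← Nat.cast_smul_eq_nsmul ℝ,
      smul_smul]
    norm_num
  have hcurry : ContDiff ℝ ∞ fun B => curry B := ContinuousLinearMap.contDiff _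
  exact (((ContinuousLinearMap.contDiff _).comp_contDiffOn
    (hcurry.comp_contDiffOn hτ)).const_smul _).congr fun x _ => hτ_eq x

theorem contDiffOn_compContinuousLinearMap {τ : G → F [⋀^Fin 2]→L[ℝ] ℝ} {A : G → E →L[ℝ] F}
    {W : Set G} (hτ : ContDiffOn ℝ ∞ τ W) (hA : ContDiffOn ℝ ∞ A W) :
    ContDiffOn ℝ ∞ (fun x => (τ x).compContinuousLinearMap (A x)) W := by
  refine contDiffOn_of_contDiffOn_bilinOfForm ?_
  have hprecomp : ContDiffOn ℝ ∞ (fun x => (ContinuousLinearMap.compL ℝ E F ℝ).flip (A x)) W :=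
    (ContinuousLinearMap.contDiff _).comp_contDiffOn hA
  refine (hprecomp.clm_comp
    ((contDiff_bilinOfForm.comp_contDiffOn hτ).clm_comp hA)).congr fun x _ => ?_
  ext a b
  rw [bilinOfForm_apply, compContinuousLinearMap_pair]
  simp

theorem extDeriv_compContinuousLinearMap_fderiv_eq_zero {τ : F → F [⋀^Fin 2]→L[ℝ] ℝ} {g : E → F}
    {W : Set F} {T : Set E} (hW : IsOpen W) (hT : IsOpen T) (hτ : ContDiffOn ℝ ∞ τ W)
    (hclosed : ∀ y ∈ W, extDeriv τ y = 0) (hg : ContDiffOn ℝ ∞ g T) (hgW : MapsTo g T W) {z : E}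
    (hz : z ∈ T) :
    extDeriv (fun x => (τ (g x)).compContinuousLinearMap (fderiv ℝ g x)) z = 0 := by
  have hτ_diff : DifferentiableAt ℝ τ (g z) :=
    (hasFDerivAt_of_contDiffOn hW hτ (hgW hz)).differentiableAt
  have hg_diff : ContDiffAt ℝ ∞ g z := hg.contDiffAt (hT.mem_nhds hz)
  rw [extDeriv_pullback (r := ∞) hτ_diff hg_diff
    (by simpa using WithTop.coe_le_coe.2 (le_top : (2 : ℕ∞) ≤ ⊤)), hclosed _ (hgW hz)]
  ext
  simp

end Pullback

/-! ### Local normal form along a submersion with isotropic fibres -/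

section NormalForm

variable {E F : Type*} [NormedAddCommGroup E] [NormedSpace ℝ E] [NormedAddCommGroup F]
  [NormedSpace ℝ F]

theorem exists_openPartialHomeomorph_contDiffOn_symm [CompleteSpace E] {g : E → F} {W : Set E}
    (hW : IsOpen W) (hg : ContDiffOn ℝ ∞ g W) {p : E} (hp : p ∈ W) {A : E ≃L[ℝ] F}
    (hA : HasFDerivAt g (A : E →L[ℝ] F) p) :
    ∃ ψ : OpenPartialHomeomorph E F, ⇑ψ = g ∧ p ∈ ψ.source ∧ ψ.source ⊆ W ∧
      ContDiffOn ℝ ∞ ψ.symm ψ.target := by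
  set S : Set (E →L[ℝ] F) := range ((↑) : (E ≃L[ℝ] F) → E →L[ℝ] F)
  -- Smoothness of the inverse needs an invertible derivative everywhere, not only at `p`.
  have hO : IsOpen (W ∩ fderiv ℝ g ⁻¹' S) :=
    (hg.continuousOn_fderiv_of_isOpen hW (by simp)).isOpen_inter_preimage hW
      ContinuousLinearEquiv.isOpen
  have hgp : ContDiffAt ℝ ∞ g p := hg.contDiffAt (hW.mem_nhds hp)
  set ψ := hgp.toOpenPartialHomeomorph g hA (by simp)
  have hsource : (ψ.restrOpen _ hO).source = ψ.source ∩ (W ∩ fderiv ℝ g ⁻¹' S) :=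
    ψ.restrOpen_source _ hO
  refine ⟨ψ.restrOpen _ hO, rfl, ?_, ?_, fun z hz => ?_⟩
  · rw [hsource]
    exact ⟨hgp.mem_toOpenPartialHomeomorph_source hA (by simp), hp, A, hA.fderiv.symm⟩
  · rw [hsource]
    exact fun y hy => hy.2.1
  · obtain ⟨-, hyW, B, hB⟩ := hsource ▸ (ψ.restrOpen _ hO).map_target hz
    exact (OpenPartialHomeomorph.contDiffAt_symm _ hz
      (hB ▸ hasFDerivAt_of_contDiffOn hW hg hyW : HasFDerivAt g (B : E →L[ℝ] F) _)
      (hg.contDiffAt (hW.mem_nhds hyW))).contDiffWithinAt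

theorem exists_straightening [CompleteSpace E] {f : E → F} {W : Set E} (hW : IsOpen W)
    (hf : ContDiffOn ℝ ∞ f W) {p : E} (hp : p ∈ W) {s : F →L[ℝ] E}
    (hs : ∀ c, fderiv ℝ f p (s c) = c) :
    ∃ ψ : OpenPartialHomeomorph E E, p ∈ ψ.source ∧ ψ.source ⊆ W ∧ ψ p = 0 ∧
      ContDiffOn ℝ ∞ ψ ψ.source ∧ ContDiffOn ℝ ∞ ψ.symm ψ.target ∧
      ∀ y ∈ ψ.source, fderiv ℝ f y = (fderiv ℝ f p).comp (fderiv ℝ ψ y) := by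
  set L := fderiv ℝ f p
  set g : E → E := fun y => (y - p) + s (f y - f p - L (y - p)) with hg
  have hg_smooth : ContDiffOn ℝ ∞ g W :=
    (contDiffOn_id.sub contDiffOn_const).add (s.contDiff.comp_contDiffOn
      ((hf.sub contDiffOn_const).sub
        (L.contDiff.comp_contDiffOn (contDiffOn_id.sub contDiffOn_const))))
  have hsub : HasFDerivAt (fun y => y - p) (.id ℝ E) p := (hasFDerivAt_id p).sub_const p
  have hg_deriv : HasFDerivAt g (ContinuousLinearEquiv.refl ℝ E : E →L[ℝ] E) p := by
    have h := hsub.fun_add (s.hasFDerivAt.comp p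
      (((hasFDerivAt_of_contDiffOn hW hf hp).sub_const (f p)).fun_sub (L.hasFDerivAt.comp p hsub)))
    refine h.congr_fderiv ?_
    ext v
    simp [L]
  obtain ⟨ψ, hψ, hpψ, hψW, hψ_symm⟩ :=
    exists_openPartialHomeomorph_contDiffOn_symm hW hg_smooth hp hg_deriv
  have hψ_smooth : ContDiffOn ℝ ∞ ψ ψ.source := hψ ▸ hg_smooth.mono hψW
  refine ⟨ψ, hpψ, hψW, by simp [hψ, hg], hψ_smooth, hψ_symm, fun y hy => ?_⟩
  have hf_eq : f = fun z => L (ψ z) + f p := funext fun z => by simp [hψ, hg, hs]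
  rw [hf_eq]
  exact ((L.hasFDerivAt.comp y
    (hasFDerivAt_of_contDiffOn ψ.open_source hψ_smooth hy)).add_const (f p)).fderiv

theorem fderiv_symm_apply_fderiv {ψ : OpenPartialHomeomorph E F}
    (hψ : ContDiffOn ℝ ∞ ψ ψ.source) (hψ_symm : ContDiffOn ℝ ∞ ψ.symm ψ.target) {y : E}
    (hy : y ∈ ψ.source) (v : E) : fderiv ℝ ψ.symm (ψ y) (fderiv ℝ ψ y v) = v := by
  have hcomp := (hasFDerivAt_of_contDiffOn ψ.open_target hψ_symm (ψ.map_source hy)).comp y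
    (hasFDerivAt_of_contDiffOn ψ.open_source hψ hy)
  have hid : ψ.symm ∘ ψ =ᶠ[nhds y] id :=
    Filter.eventually_of_mem (ψ.open_source.mem_nhds hy) fun z hz => ψ.left_inv hz
  exact congr($(hcomp.unique ((hasFDerivAt_id y).congr_of_eventuallyEq hid)) v)

theorem exists_eq_fderiv_apply_sub_near_zero {W : Set E} (hW : IsOpen W) (h0 : (0 : E) ∈ W)
    {τ : E → E [⋀^Fin 2]→L[ℝ] ℝ} (hτ : ContDiffOn ℝ ∞ τ W) (hclosed : ∀ x ∈ W, extDeriv τ x = 0)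
    {L : E →L[ℝ] F} {s : F →L[ℝ] E} (hLs : ∀ c, L (s c) = c)
    (hiso : ∀ x ∈ W, ∀ a b, L a = 0 → L b = 0 → τ x ![a, b] = 0) :
    ∃ U : Set E, IsOpen U ∧ (0 : E) ∈ U ∧ ∃ η : E → F →L[ℝ] ℝ, ContDiffOn ℝ ∞ η U ∧
      η 0 = 0 ∧ ∀ x ∈ U, ∀ a b, τ x ![a, b] = fderiv ℝ η x b (L a) - fderiv ℝ η x a (L b) := by
  obtain ⟨r, hr, hball⟩ := Metric.isOpen_iff.1 hW 0 h0
  set U : Set E := Metric.ball 0 r ∩ s.comp L ⁻¹' Metric.ball 0 r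
  have hU : IsOpen U := Metric.isOpen_ball.inter (Metric.isOpen_ball.preimage (s.comp L).continuous)
  have hUW : U ⊆ W := inter_subset_left.trans hball
  have hconv : Convex ℝ U :=
    (convex_ball 0 r).inter ((convex_ball 0 r).linear_preimage (s.comp L).toLinearMap)
  have hmaps : MapsTo (s.comp L) U U := fun x hx => ⟨hx.2, by simpa [hLs] using hx.2⟩
  have h0U : (0 : E) ∈ U := by simpa [U] using hr
  exact ⟨U, hU, h0U, exists_eq_fderiv_apply_sub_of_isotropic_ker hconv hU h0U (hτ.mono hUW)
    (fun x hx => hclosed x (hUW hx)) hLs hmaps fun x hx => hiso x (hUW hx)⟩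

/-- In straightening coordinates the fibres of `f` are parallel to `ker f'(p)`. -/
theorem exists_eq_fderiv_apply_sub_of_isotropic_fibers [CompleteSpace E] {W : Set E}
    (hW : IsOpen W) {τ : E → E [⋀^Fin 2]→L[ℝ] ℝ} (hτ : ContDiffOn ℝ ∞ τ W)
    (hclosed : ∀ y ∈ W, extDeriv τ y = 0) {f : E → F} (hf : ContDiffOn ℝ ∞ f W)
    (hiso : ∀ y ∈ W, ∀ a b, fderiv ℝ f y a = 0 → fderiv ℝ f y b = 0 → τ y ![a, b] = 0)
    {p : E} (hp : p ∈ W) {s : F →L[ℝ] E} (hs : ∀ c, fderiv ℝ f p (s c) = c) :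
    ∃ U : Set E, IsOpen U ∧ p ∈ U ∧ U ⊆ W ∧ ∃ η : E → F →L[ℝ] ℝ, ContDiffOn ℝ ∞ η U ∧ η p = 0 ∧
      ∀ y ∈ U, ∀ a b,
        τ y ![a, b] = fderiv ℝ η y b (fderiv ℝ f y a) - fderiv ℝ η y a (fderiv ℝ f y b) := by
  obtain ⟨ψ, hpψ, hψW, hψp, hψ, hψ_symm, hdf⟩ := exists_straightening hW hf hp hs
  set L := fderiv ℝ f p
  have hsymmW : MapsTo ψ.symm ψ.target W := fun z hz => hψW (ψ.map_target hz)
  have hker : ∀ z ∈ ψ.target, ∀ v, L v = 0 → fderiv ℝ f (ψ.symm z) (fderiv ℝ ψ.symm z v) = 0 :=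
    fun z hz v hv => by
      have h := fderiv_symm_apply_fderiv (ψ := ψ.symm) hψ_symm hψ hz v
      rw [ψ.symm_symm] at h
      rw [hdf _ (ψ.map_target hz), ContinuousLinearMap.comp_apply, h, hv]
  obtain ⟨T, hT, h0T, η, hη, hη0, hη_eq⟩ := exists_eq_fderiv_apply_sub_near_zero
    (τ := fun z => (τ (ψ.symm z)).compContinuousLinearMap (fderiv ℝ ψ.symm z))
    ψ.open_target (hψp ▸ ψ.map_source hpψ)
    (contDiffOn_compContinuousLinearMap (hτ.comp hψ_symm hsymmW)
      (hψ_symm.fderiv_of_isOpen ψ.open_target (by simp)))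
    (fun z hz => extDeriv_compContinuousLinearMap_fderiv_eq_zero hW ψ.open_target hτ hclosed
      hψ_symm hsymmW hz) hs
    (fun z hz a b ha hb => by
      rw [compContinuousLinearMap_pair]
      exact hiso _ (hsymmW hz) _ _ (hker z hz a ha) (hker z hz b hb))
  refine ⟨ψ.source ∩ ψ ⁻¹' T, ψ.isOpen_inter_preimage hT, ⟨hpψ, by rwa [mem_preimage, hψp]⟩,
    inter_subset_left.trans hψW, η ∘ ψ, hη.comp (hψ.mono inter_subset_left) fun _ hy => hy.2,
    by rw [comp_apply, hψp, hη0], fun y hy a b => ?_⟩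
  have h := hη_eq (ψ y) hy.2 (fderiv ℝ ψ y a) (fderiv ℝ ψ y b)
  rw [compContinuousLinearMap_pair, ψ.left_inv hy.1, fderiv_symm_apply_fderiv hψ hψ_symm hy.1,
    fderiv_symm_apply_fderiv hψ hψ_symm hy.1] at h
  rw [h, hdf y hy.1, ((hasFDerivAt_of_contDiffOn hT hη hy.2).comp y
    (hasFDerivAt_of_contDiffOn ψ.open_source hψ hy.1)).fderiv]
  rfl

theorem isOpen_setOf_surjective [FiniteDimensional ℝ F] :
    IsOpen {A : E →L[ℝ] F | Surjective A} := by
  have : CompleteSpace F := FiniteDimensional.complete ℝ F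
  refine isOpen_iff_mem_nhds.2 fun A hA => ?_
  obtain ⟨s, hs⟩ := ContinuousLinearMap.HasRightInverse.of_surjective_of_finiteDimensional hA
  have hcomp : Continuous fun B : E →L[ℝ] F => B.comp s := by fun_prop
  refine Filter.mem_of_superset ((ContinuousLinearEquiv.isOpen.preimage hcomp).mem_nhds
    ⟨.refl ℝ F, ContinuousLinearMap.ext fun c => (hs c).symm⟩) ?_
  rintro B ⟨e, he⟩
  have hBs : Surjective (B ∘ s) := by
    have hcoe : ⇑e = B ∘ s := congrArg DFunLike.coe he
    exact hcoe ▸ e.surjective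
  exact hBs.of_comp

end NormalForm

/-! ### Linear symplectic algebra -/

theorem isotropic_ker_of_involution {K V ι : Type*} [Field K] [AddCommGroup V] [Module K V]
    [FiniteDimensional K V] [Fintype ι] (hV : Module.finrank K V ≤ 2 * Fintype.card ι)
    {B : V →ₗ[K] V →ₗ[K] K} {L : V →ₗ[K] ι → K} (hL : Surjective L) {X : ι → V}
    (hX : ∀ i v, B (X i) v = -L v i) (hinv : ∀ i j, B (X i) (X j) = 0) {a b : V}
    (ha : L a = 0) (hb : L b = 0) : B a b = 0 := by
  classical
  set T := Fintype.linearCombination K X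
  have hT : ∀ c v, B (T c) v = -∑ i, c i * L v i := fun c v => by
    simp [T, Fintype.linearCombination_apply, hX]
  have hT_inj : Injective T := by
    refine (injective_iff_map_eq_zero T).2 fun c hc => funext fun j => ?_
    obtain ⟨v, hv⟩ := hL (Pi.single j 1)
    simpa [hc, hv, Pi.single_apply] using (hT c v).symm
  have hLX : ∀ i, L (X i) = 0 := fun i => funext fun j => by
    simpa [hinv] using (hX j (X i)).symm
  have hle : LinearMap.range T ≤ LinearMap.ker L := by
    rintro _ ⟨c, rfl⟩
    simp [T, Fintype.linearCombination_apply, hLX]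
  have hrange : LinearMap.range T = LinearMap.ker L := by
    refine Submodule.eq_of_le_of_finrank_le hle ?_
    have hrank := L.finrank_range_add_finrank_ker
    rw [LinearMap.range_eq_top.2 hL, finrank_top, Module.finrank_fintype_fun_eq_card] at hrank
    rw [LinearMap.finrank_range_of_inj hT_inj, Module.finrank_fintype_fun_eq_card]
    omega
  obtain ⟨c, rfl⟩ : a ∈ LinearMap.range T := hrange ▸ ha
  simp [hT, hb]

/-- The right-hand side of the last clause is the pullback by `ψ` of the canonical two-form of the
cotangent bundle `F* × F`. -/
theorem exists_cotangent_chart_of_isotropic_fibers {E F : Type*} [NormedAddCommGroup E]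
    [NormedSpace ℝ E] [FiniteDimensional ℝ E] [NormedAddCommGroup F] [NormedSpace ℝ F]
    [FiniteDimensional ℝ F] (hdim : Module.finrank ℝ E = 2 * Module.finrank ℝ F) {W : Set E}
    (hW : IsOpen W) {τ : E → E [⋀^Fin 2]→L[ℝ] ℝ} (hτ : ContDiffOn ℝ ∞ τ W)
    (hclosed : ∀ y ∈ W, extDeriv τ y = 0) {f : E → F} (hf : ContDiffOn ℝ ∞ f W)
    (hiso : ∀ y ∈ W, ∀ a b, fderiv ℝ f y a = 0 → fderiv ℝ f y b = 0 → τ y ![a, b] = 0)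
    {p : E} (hp : p ∈ W) (hnondeg : ∀ v, (∀ w, τ p ![v, w] = 0) → v = 0)
    (hsurj : Surjective (fderiv ℝ f p)) :
    ∃ ψ : OpenPartialHomeomorph E ((F →L[ℝ] ℝ) × F), p ∈ ψ.source ∧
      ContDiffOn ℝ ∞ ψ ψ.source ∧ ContDiffOn ℝ ∞ ψ.symm ψ.target ∧ ψ p = 0 ∧
      (∀ y ∈ ψ.source, (ψ y).2 = f y - f p) ∧
      ∀ y ∈ ψ.source, ∀ a b, τ y ![a, b] =
        (fderiv ℝ ψ y b).1 (fderiv ℝ ψ y a).2 - (fderiv ℝ ψ y a).1 (fderiv ℝ ψ y b).2 := by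
  have : CompleteSpace E := FiniteDimensional.complete ℝ E
  obtain ⟨s, hs⟩ := ContinuousLinearMap.HasRightInverse.of_surjective_of_finiteDimensional hsurj
  obtain ⟨U, hU, hpU, hUW, η, hη, hηp, hτη⟩ :=
    exists_eq_fderiv_apply_sub_of_isotropic_fibers hW hτ hclosed hf hiso hp hs
  have hderiv : ∀ y ∈ U, HasFDerivAt (fun z => (η z, f z - f p))
      ((fderiv ℝ η y).prod (fderiv ℝ f y)) y := fun y hy =>
    (hasFDerivAt_of_contDiffOn hU hη hy).prodMk
      ((hasFDerivAt_of_contDiffOn hW hf (hUW hy)).sub_const (f p))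
  have hsmooth : ContDiffOn ℝ ∞ (fun z => (η z, f z - f p)) U :=
    hη.prodMk ((hf.mono hUW).sub contDiffOn_const)
  have hinj : Injective ((fderiv ℝ η p).prod (fderiv ℝ f p)) :=
    (injective_iff_map_eq_zero _).2 fun v hv => hnondeg v fun w => by
      obtain ⟨hηv, hfv⟩ : fderiv ℝ η p v = 0 ∧ fderiv ℝ f p v = 0 := Prod.ext_iff.1 hv
      simp [hτη p hpU, hηv, hfv]
  have hrank : Module.finrank ℝ E = Module.finrank ℝ ((F →L[ℝ] ℝ) × F) := by
    rw [Module.finrank_prod, hdim, two_mul,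
      ← (LinearMap.toContinuousLinearMap (𝕜 := ℝ) (E := F) (F' := ℝ)).finrank_eq]
    exact congrArg (· + _) Subspace.dual_finrank_eq.symm
  obtain ⟨ψ, hψ, hpψ, hψU, hψ_symm⟩ := exists_openPartialHomeomorph_contDiffOn_symm hU hsmooth hpU
    (A := (LinearEquiv.ofInjectiveOfFinrankEq _ hinj hrank).toContinuousLinearEquiv)
    ((hderiv p hpU).congr_fderiv rfl)
  refine ⟨ψ, hpψ, hψ ▸ hsmooth.mono hψU, hψ_symm, by simp [hψ, hηp], fun y _ => by rw [hψ],
    fun y hy a b => ?_⟩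
  rw [hψ, (hderiv y (hψU hy)).fderiv]
  exact hτη y (hψU hy) a b

/-! ### Darboux coordinates in a chart -/

theorem exists_eq_xIndex_or_eq_xiIndex {n : ℕ} (k : Fin (2 * n)) :
    (∃ i : Fin n, k = xIndex i) ∨ ∃ i : Fin n, k = xiIndex i := by
  by_cases hk : (k : ℕ) < n
  · exact .inl ⟨⟨k, hk⟩, rfl⟩
  · exact .inr ⟨⟨k - n, by omega⟩, Fin.ext (by simp only [xiIndex]; omega)⟩

theorem clm_apply_eq_sum_single {ι : Type*} [Fintype ι] [DecidableEq ι]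
    (α : EuclideanSpace ℝ ι →L[ℝ] ℝ) (c : EuclideanSpace ℝ ι) :
    α c = ∑ i, c i * α (EuclideanSpace.single i 1) := by
  conv_lhs => rw [← (EuclideanSpace.basisFun ι ℝ).sum_repr c]
  simp

/-- The identification of `ℝ²ⁿ` with the cotangent bundle of `ℝⁿ` in which `ξ` is the base point
and `x` lists the components of the covector. -/
def cotangentEquiv (n : ℕ) : R2 n ≃L[ℝ] (R1 n →L[ℝ] ℝ) × R1 n :=
  LinearEquiv.toContinuousLinearEquiv
    { toFun := fun v => (∑ i, v (xIndex i) • EuclideanSpace.proj i, xiMap n v)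
      map_add' := fun v w => by
        simp [add_smul, Finset.sum_add_distrib, xiMap, ← WithLp.toLp_add, Pi.add_def]
      map_smul' := fun c v => by
        simp [mul_smul, Finset.smul_sum, xiMap, ← WithLp.toLp_smul, Pi.smul_def]
      invFun := fun q => WithLp.toLp 2 fun k =>
        if hk : (k : ℕ) < n then q.1 (EuclideanSpace.single ⟨k, hk⟩ 1) else q.2 ⟨k - n, by omega⟩
      left_inv := fun v => by
        ext k
        rcases exists_eq_xIndex_or_eq_xiIndex k with ⟨i, rfl⟩ | ⟨i, rfl⟩
        · simp [xIndex]
        · simp [xiIndex, xiMap]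
      right_inv := fun q => Prod.ext
        (ContinuousLinearMap.ext fun c => by
          simp [xIndex, clm_apply_eq_sum_single q.1 c, mul_comm])
        (by ext i; simp [xiIndex, xiMap]) }

theorem cotangentEquiv_symm_xIndex {n : ℕ} (q : (R1 n →L[ℝ] ℝ) × R1 n) (i : Fin n) :
    (cotangentEquiv n).symm q (xIndex i) = q.1 (EuclideanSpace.single i 1) :=
  dif_pos i.2

theorem cotangentEquiv_symm_xiIndex {n : ℕ} (q : (R1 n →L[ℝ] ℝ) × R1 n) (i : Fin n) :
    (cotangentEquiv n).symm q (xiIndex i) = q.2 i := by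
  simp [cotangentEquiv, xiIndex]

theorem form_ext {V : Type*} [AddCommGroup V] [Module ℝ V] [TopologicalSpace V]
    {α β : V [⋀^Fin 2]→L[ℝ] ℝ} (h : ∀ v w, α ![v, w] = β ![v, w]) : α = β := by
  ext v
  rw [List.ofFn_inj.1 (by simp : List.ofFn v = List.ofFn ![v 0, v 1])]
  exact h _ _

theorem sum_wedge_apply {ι V : Type*} [Fintype ι] [AddCommGroup V] [Module ℝ V]
    [TopologicalSpace V] (α β : ι → V →L[ℝ] ℝ) (v w : V) :
    (∑ i, wedge (α i) (β i)) ![v, w] = ∑ i, (α i v * β i w - α i w * β i v) := by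
  simp only [ContinuousAlternatingMap.sum_apply, wedge_apply]

theorem canonicalForm_apply {n : ℕ} (q v w : R2 n) :
    canonicalForm n q ![v, w] =
      ∑ i : Fin n, (v (xiIndex i) * w (xIndex i) - w (xiIndex i) * v (xIndex i)) := by
  have hcoord (k : Fin (2 * n)) (u : R2 n) :
      differential (n := n) (fun q : R2 n => q k) q u = u k := by
    rw [differential, mfderiv_eq_fderiv]
    exact congrArg (fun l : R2 n →L[ℝ] ℝ => l u) (EuclideanSpace.proj (𝕜 := ℝ) k).fderiv
  refine (sum_wedge_apply _ _ v w).trans (Finset.sum_congr rfl fun i _ => ?_)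
  exact congrArg₂ (· - ·) (congrArg₂ (· * ·) (hcoord _ v) (hcoord _ w))
    (congrArg₂ (· * ·) (hcoord _ w) (hcoord _ v))

theorem canonicalForm_cotangentEquiv_symm {n : ℕ} (p : R2 n) (q r : (R1 n →L[ℝ] ℝ) × R1 n) :
    canonicalForm n p ![(cotangentEquiv n).symm q, (cotangentEquiv n).symm r] =
      r.1 q.2 - q.1 r.2 := by
  rw [clm_apply_eq_sum_single r.1, clm_apply_eq_sum_single q.1, ← Finset.sum_sub_distrib]
  refine (canonicalForm_apply p _ _).trans (Finset.sum_congr rfl fun i _ => ?_)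
  simp only [cotangentEquiv_symm_xIndex, cotangentEquiv_symm_xiIndex]

theorem exists_darboux_chart_of_isotropic_fibers {n : ℕ} {W : Set (R2 n)} (hW : IsOpen W)
    {τ : R2 n → R2 n [⋀^Fin 2]→L[ℝ] ℝ} (hτ : ContDiffOn ℝ ∞ τ W)
    (hclosed : ∀ y ∈ W, extDeriv τ y = 0) {f : R2 n → R1 n} (hf : ContDiffOn ℝ ∞ f W)
    (hiso : ∀ y ∈ W, ∀ a b, fderiv ℝ f y a = 0 → fderiv ℝ f y b = 0 → τ y ![a, b] = 0)
    {p : R2 n} (hp : p ∈ W) (hnondeg : ∀ v, (∀ w, τ p ![v, w] = 0) → v = 0)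
    (hsurj : Surjective (fderiv ℝ f p)) :
    ∃ ψ : OpenPartialHomeomorph (R2 n) (R2 n), p ∈ ψ.source ∧ ContDiffOn ℝ ∞ ψ ψ.source ∧
      ContDiffOn ℝ ∞ ψ.symm ψ.target ∧ ψ p = 0 ∧
      (∀ y ∈ ψ.source, xiMap n (ψ y) = f y - f p) ∧
      ∀ y ∈ ψ.source, pullback (n := n) ψ (canonicalForm n) y = τ y := by
  obtain ⟨ψ, hpψ, hψ, hψ_symm, hψp, hψ_snd, hτψ⟩ := exists_cotangent_chart_of_isotropic_fibers
    (by simp) hW hτ hclosed hf hiso hp hnondeg hsurj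
  set T := cotangentEquiv n
  refine ⟨ψ.transHomeomorph T.symm.toHomeomorph, hpψ, T.symm.contDiff.comp_contDiffOn hψ,
    hψ_symm.comp T.contDiff.contDiffOn fun _ hz => hz, ?_, fun y hy => ?_,
    fun y hy => form_ext fun a b => ?_⟩
  · simp [hψp]
  · ext i
    exact (cotangentEquiv_symm_xiIndex _ i).trans congr($(hψ_snd y hy) i)
  · have hderiv (v : R2 n) : mfderiv (𝓡 (2 * n)) (𝓡 (2 * n)) (T.symm ∘ ψ) y v =
        T.symm (fderiv ℝ ψ y v) := by
      rw [mfderiv_eq_fderiv]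
      exact congr($(T.symm.comp_fderiv) v)
    calc pullback (n := n) (T.symm ∘ ψ) (canonicalForm n) y ![a, b]
        = canonicalForm n (T.symm (ψ y)) ![mfderiv (𝓡 (2 * n)) (𝓡 (2 * n)) (T.symm ∘ ψ) y a,
            mfderiv (𝓡 (2 * n)) (𝓡 (2 * n)) (T.symm ∘ ψ) y b] :=
          compContinuousLinearMap_pair _ _ a b
      _ = canonicalForm n (T.symm (ψ y)) ![T.symm (fderiv ℝ ψ y a), T.symm (fderiv ℝ ψ y b)] :=
          congrArg₂ (fun u v => canonicalForm n (T.symm (ψ y)) ![u, v]) (hderiv a) (hderiv b)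
      _ = (fderiv ℝ ψ y b).1 (fderiv ℝ ψ y a).2 - (fderiv ℝ ψ y a).1 (fderiv ℝ ψ y b).2 :=
          canonicalForm_cotangentEquiv_symm _ _ _
      _ = τ y ![a, b] := (hτψ y hy a b).symm

/-! ### Pullbacks on manifolds -/

section Pullbacks

variable {n : ℕ} {M N P : Type*} [TopologicalSpace M] [ChartedSpace (R2 n) M]
  [TopologicalSpace N] [ChartedSpace (R2 n) N] [TopologicalSpace P] [ChartedSpace (R2 n) P]

theorem pullback_apply (f : M → N) (σ : TwoForm n N) (p : M) (v w : TangentSpace (𝓡 (2 * n)) p) :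
    pullback (n := n) f σ p ![v, w] = σ (f p) ![mfderiv (𝓡 (2 * n)) (𝓡 (2 * n)) f p v,
      mfderiv (𝓡 (2 * n)) (𝓡 (2 * n)) f p w] :=
  compContinuousLinearMap_pair _ _ v w

theorem pullback_comp_apply {g : N → P} {f : M → N} {p : M}
    (hg : MDifferentiableAt (𝓡 (2 * n)) (𝓡 (2 * n)) g (f p))
    (hf : MDifferentiableAt (𝓡 (2 * n)) (𝓡 (2 * n)) f p) (σ : TwoForm n P) :
    pullback (n := n) (g ∘ f) σ p = pullback (n := n) f (pullback (n := n) g σ) p := by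
  rw [pullback, mfderiv_comp p hg hf]
  rfl

theorem pullback_eq_self_of_eventuallyEq_id {f : M → M} {p : M} (hf : f =ᶠ[nhds p] id)
    (σ : TwoForm n M) : pullback (n := n) f σ p = σ p := by
  have hbase {q : M} (hq : q = p) (a b : R2 n) : σ q ![a, b] = σ p ![a, b] := by rw [hq]
  have hderiv (v : R2 n) : mfderiv (𝓡 (2 * n)) (𝓡 (2 * n)) f p v = v := by
    rw [hf.mfderiv_eq, mfderiv_id]
    rfl
  refine form_ext fun a b => (pullback_apply f σ p a b).trans ((hbase hf.eq_of_nhds _ _).trans ?_)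
  exact congrArg₂ (fun u v => σ p ![u, v]) (hderiv a) (hderiv b)

theorem differential_coord {ι : Type*} [Fintype ι] {h : M → EuclideanSpace ℝ ι} {p : M}
    (hh : MDifferentiableAt (𝓡 (2 * n)) 𝓘(ℝ, EuclideanSpace ℝ ι) h p) (k : ι)
    (v : TangentSpace (𝓡 (2 * n)) p) :
    differential (n := n) (fun q => h q k) p v =
      WithLp.ofLp (p := 2) (V := ι → ℝ)
        (mfderiv (𝓡 (2 * n)) 𝓘(ℝ, EuclideanSpace ℝ ι) h p v) k := by
  let proj : EuclideanSpace ℝ ι →L[ℝ] ℝ := EuclideanSpace.proj k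
  have hcomp := mfderiv_comp p (g := proj) proj.differentiableAt.mdifferentiableAt hh
  rw [mfderiv_eq_fderiv, proj.fderiv] at hcomp
  exact congr($hcomp v)

theorem pullback_canonicalForm {e : M → R2 n} {p : M}
    (he : MDifferentiableAt (𝓡 (2 * n)) (𝓡 (2 * n)) e p) :
    pullback (n := n) e (canonicalForm n) p =
      ∑ i : Fin n, wedge (differential (n := n) (fun q => e q (xiIndex i)) p)
        (differential (n := n) (fun q => e q (xIndex i)) p) := by
  refine form_ext fun v w => ?_
  rw [sum_wedge_apply, pullback_apply]
  simp only [differential_coord he]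
  exact canonicalForm_apply _ _ _

end Pullbacks

/-! ### Systems in involution -/

section Involution

variable {n : ℕ} {M : Type*} [TopologicalSpace M] [ChartedSpace (R2 n) M] {σ : TwoForm n M}
  {F : M → R1 n}

theorem isotropic_ker_mfderiv (hσ : IsSymplectic σ) {p : M}
    (hF : MDifferentiableAt (𝓡 (2 * n)) (𝓡 n) F p)
    (hinv : ∀ i j, poissonBracket σ (fun q => F q i) (fun q => F q j) p = 0)
    (hp : IsRegularPoint F p) {v w : TangentSpace (𝓡 (2 * n)) p}
    (hv : mfderiv (𝓡 (2 * n)) (𝓡 n) F p v = 0) (hw : mfderiv (𝓡 (2 * n)) (𝓡 n) F p w = 0) :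
    σ p ![v, w] = 0 := by
  let B : R2 n →ₗ[ℝ] R2 n →ₗ[ℝ] ℝ := (bilinOfForm (R2 n) (σ p)).toLinearMap₁₂
  let L : R2 n →ₗ[ℝ] Fin n → ℝ := (WithLp.linearEquiv 2 ℝ (Fin n → ℝ)).toLinearMap ∘ₗ
    (mfderiv (𝓡 (2 * n)) (𝓡 n) F p : R2 n →L[ℝ] R1 n).toLinearMap
  have hB (a b : R2 n) : B a b = σ p ![a, b] := bilinOfForm_apply _ a b
  have hL (u : R2 n) (hu : mfderiv (𝓡 (2 * n)) (𝓡 n) F p u = 0) : L u = 0 :=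
    congrArg (WithLp.ofLp (p := 2) (V := Fin n → ℝ)) hu
  refine (hB v w).symm.trans (isotropic_ker_of_involution (B := B) (L := L)
    (X := fun i => hamiltonianVectorField σ (fun q => F q i) p) (by simp)
    ((WithLp.linearEquiv 2 ℝ (Fin n → ℝ)).surjective.comp hp) (fun i u => ?_)
    (fun i j => (hB _ _).trans (hinv i j)) (hL v hv) (hL w hw))
  exact (hB _ u).trans ((hamiltonianVectorField_spec hσ _ p u).trans
    (congrArg Neg.neg (differential_coord hF i u)))

variable {e : OpenPartialHomeomorph M (R2 n)}

theorem mfderiv_apply_mfderiv_symm (he : e.MDifferentiable (𝓡 (2 * n)) (𝓡 (2 * n))) {y : R2 n}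
    (hy : y ∈ e.target) (hF : MDifferentiableAt (𝓡 (2 * n)) (𝓡 n) F (e.symm y)) (v : R2 n) :
    mfderiv (𝓡 (2 * n)) (𝓡 n) F (e.symm y) (mfderiv (𝓡 (2 * n)) (𝓡 (2 * n)) e.symm y v) =
      fderiv ℝ (F ∘ e.symm) y v := by
  rw [← mfderiv_eq_fderiv, mfderiv_comp y hF (he.mdifferentiableAt_symm hy)]
  rfl

theorem isRegularPoint_symm_iff (he : e.MDifferentiable (𝓡 (2 * n)) (𝓡 (2 * n))) {y : R2 n}
    (hy : y ∈ e.target) (hF : MDifferentiableAt (𝓡 (2 * n)) (𝓡 n) F (e.symm y)) :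
    IsRegularPoint F (e.symm y) ↔ Surjective (fderiv ℝ (F ∘ e.symm) y) := by
  have hcomp : ⇑(fderiv ℝ (F ∘ e.symm) y) = mfderiv (𝓡 (2 * n)) (𝓡 n) F (e.symm y) ∘
      mfderiv (𝓡 (2 * n)) (𝓡 (2 * n)) e.symm y :=
    funext fun v => (mfderiv_apply_mfderiv_symm he hy hF v).symm
  rw [hcomp]
  exact (Surjective.of_comp_iff _ (he.symm.mfderiv_surjective hy)).symm

theorem eq_zero_of_forall_inChart_eq_zero (hσ : IsSymplectic σ)
    (he : e.MDifferentiable (𝓡 (2 * n)) (𝓡 (2 * n))) {y : R2 n} (hy : y ∈ e.target) {v : R2 n}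
    (hv : ∀ w, inChart σ e y ![v, w] = 0) : v = 0 := by
  refine he.symm.mfderiv_injective hy ((hσ.nondegenerate _ _ fun w => ?_).trans (map_zero _).symm)
  obtain ⟨u, rfl⟩ := he.symm.mfderiv_surjective hy w
  exact (pullback_apply _ σ y v u).symm.trans (hv u)

theorem inChart_apply_eq_zero_of_fderiv_eq_zero (hσ : IsSymplectic σ)
    (he : e.MDifferentiable (𝓡 (2 * n)) (𝓡 (2 * n))) {y : R2 n} (hy : y ∈ e.target)
    (hF : MDifferentiableAt (𝓡 (2 * n)) (𝓡 n) F (e.symm y))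
    (hinv : ∀ i j, poissonBracket σ (fun q => F q i) (fun q => F q j) (e.symm y) = 0)
    (hsurj : Surjective (fderiv ℝ (F ∘ e.symm) y)) {a b : R2 n}
    (ha : fderiv ℝ (F ∘ e.symm) y a = 0) (hb : fderiv ℝ (F ∘ e.symm) y b = 0) :
    inChart σ e y ![a, b] = 0 :=
  (pullback_apply _ σ y a b).trans
    (isotropic_ker_mfderiv hσ hF hinv ((isRegularPoint_symm_iff he hy hF).2 hsurj)
      ((mfderiv_apply_mfderiv_symm he hy hF a).trans ha)
      ((mfderiv_apply_mfderiv_symm he hy hF b).trans hb))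

theorem pullback_trans_apply (he : e.MDifferentiable (𝓡 (2 * n)) (𝓡 (2 * n))) {ψ : R2 n → R2 n}
    {p : M} (hp : p ∈ e.source) (hψ : MDifferentiableAt (𝓡 (2 * n)) (𝓡 (2 * n)) ψ (e p))
    {τ : TwoForm n (R2 n)} (hτ : pullback (n := n) ψ τ (e p) = inChart σ e (e p)) :
    pullback (n := n) (ψ ∘ e) τ p = σ p := by
  have hid : e.symm ∘ e =ᶠ[nhds p] id :=
    Filter.eventually_of_mem (e.open_source.mem_nhds hp) fun q hq => e.left_inv hq
  have hep := he.mdifferentiableAt hp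
  have hsymm := he.mdifferentiableAt_symm (e.map_source hp)
  rw [pullback_comp_apply hψ hep, ← pullback_eq_self_of_eventuallyEq_id hid σ,
    pullback_comp_apply hsymm hep]
  exact congrArg (fun α : R2 n [⋀^Fin 2]→L[ℝ] ℝ => α.compContinuousLinearMap
    (mfderiv (𝓡 (2 * n)) (𝓡 (2 * n)) e p)) hτ

theorem trans_mem_maximalAtlas [IsManifold (𝓡 (2 * n)) ∞ M]
    (he : e ∈ IsManifold.maximalAtlas (𝓡 (2 * n)) ∞ M)
    {ψ : OpenPartialHomeomorph (R2 n) (R2 n)} (hψ : ContDiffOn ℝ ∞ ψ ψ.source)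
    (hψ_symm : ContDiffOn ℝ ∞ ψ.symm ψ.target) :
    e.trans ψ ∈ IsManifold.maximalAtlas (𝓡 (2 * n)) ∞ M := by
  refine OpenPartialHomeomorph.mem_maximalAtlas_of_contMDiffOn _ ?_ ?_
  · exact hψ.contMDiffOn.comp ((contMDiffOn_of_mem_maximalAtlas he).mono inter_subset_left)
      inter_subset_right
  · rw [OpenPartialHomeomorph.trans_target]
    exact (contMDiffOn_symm_of_mem_maximalAtlas he).comp
      (hψ_symm.contMDiffOn.mono inter_subset_left) inter_subset_right

theorem exists_darboux_chart [IsManifold (𝓡 (2 * n)) ∞ M] (hσ : IsSymplectic σ)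
    (hF : ContMDiff (𝓡 (2 * n)) (𝓡 n) ∞ F)
    (hinv : ∀ i j p, poissonBracket σ (fun q => F q i) (fun q => F q j) p = 0) {m : M}
    (hm : IsRegularPoint F m) :
    ∃ e ∈ IsManifold.maximalAtlas (𝓡 (2 * n)) ∞ M, m ∈ e.source ∧ e m = 0 ∧
      (∀ p ∈ e.source, xiMap n (e p) = F p - F m) ∧
      ∀ p ∈ e.source, pullback (n := n) e (canonicalForm n) p = σ p := by
  set c := chartAt (R2 n) m
  have hc_atlas : c ∈ atlas (R2 n) M := chart_mem_atlas _ m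
  have hc_max : c ∈ IsManifold.maximalAtlas (𝓡 (2 * n)) ∞ M := IsManifold.chart_mem_maximalAtlas m
  have : IsManifold (𝓡 (2 * n)) 1 M := .of_le (n := ∞) (by simp)
  have hc : c.MDifferentiable (𝓡 (2 * n)) (𝓡 (2 * n)) := mdifferentiable_chart m
  have hmc : m ∈ c.source := mem_chart_source _ m
  have hf : ContDiffOn ℝ ∞ (F ∘ c.symm) c.target :=
    (hF.comp_contMDiffOn (contMDiffOn_symm_of_mem_maximalAtlas hc_max)).contDiffOn
  have hFd (p : M) : MDifferentiableAt (𝓡 (2 * n)) (𝓡 n) F p := hF.mdifferentiableAt (by simp)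
  set W : Set (R2 n) := c.target ∩ fderiv ℝ (F ∘ c.symm) ⁻¹' {A | Surjective A}
  have hW : IsOpen W :=
    (hf.continuousOn_fderiv_of_isOpen c.open_target (by simp)).isOpen_inter_preimage
      c.open_target isOpen_setOf_surjective
  have hWc : W ⊆ c.target := inter_subset_left
  have hsurj : Surjective (fderiv ℝ (F ∘ c.symm) (c m)) :=
    (isRegularPoint_symm_iff hc (c.map_source hmc) (hFd _)).1 (by rwa [c.left_inv hmc])
  obtain ⟨ψ, hmψ, hψ, hψ_symm, hψm, hξ, hψτ⟩ := exists_darboux_chart_of_isotropic_fibers hW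
    ((hσ.smooth c hc_atlas).mono hWc) (fun y hy => hσ.closed c hc_atlas y hy.1) (hf.mono hWc)
    (fun y hy a b => inChart_apply_eq_zero_of_fderiv_eq_zero hσ hc hy.1 (hFd _)
      (fun i j => hinv i j _) hy.2)
    ⟨c.map_source hmc, hsurj⟩
    (fun v => eq_zero_of_forall_inChart_eq_zero hσ hc (c.map_source hmc)) hsurj
  refine ⟨c.trans ψ, trans_mem_maximalAtlas hc_max hψ hψ_symm, ⟨hmc, hmψ⟩, hψm,
    fun p hp => ?_, fun p hp => ?_⟩
  · simpa [c.left_inv hp.1, c.left_inv hmc] using hξ (c p) hp.2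
  · exact pullback_trans_apply hc hp.1
      ((hψ.contDiffAt (ψ.open_source.mem_nhds hp.2)).differentiableAt (by simp)).mdifferentiableAt
      (hψτ (c p) hp.2)

end Involution

/-! ### Charts as symplectic equivalences -/

theorem range_restrictMap_eq_of_forall_eq {n : ℕ} {M : Type*} [TopologicalSpace M]
    {e : OpenPartialHomeomorph M (R2 n)} {f : M → R1 n} {G : R2 n → R1 n}
    (hG : ∀ p ∈ e.source, G (e p) = f p) :
    range (restrictMap f ⟨e.source, e.open_source⟩) =
      range (restrictMap G ⟨e.target, e.open_target⟩) := by
  have hf : restrictMap f ⟨e.source, e.open_source⟩ =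
      restrictMap G ⟨e.target, e.open_target⟩ ∘ e.toHomeomorphSourceTarget :=
    funext fun p => (hG p p.2).symm
  rw [hf]
  exact e.toHomeomorphSourceTarget.surjective.range_comp _

section Charts

variable {n : ℕ} {M : Type*} [TopologicalSpace M] [ChartedSpace (R2 n) M]
  {e : OpenPartialHomeomorph M (R2 n)}

/-- A smooth chart, regarded as a diffeomorphism from its domain onto its image. -/
def chartDiffeomorph (he : e ∈ IsManifold.maximalAtlas (𝓡 (2 * n)) ∞ M) :
    (⟨e.source, e.open_source⟩ : Opens M) ≃ₘ^∞⟮𝓡 (2 * n), 𝓡 (2 * n)⟯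
      (⟨e.target, e.open_target⟩ : Opens (R2 n)) where
  toFun p := ⟨e p, e.map_source p.2⟩
  invFun y := ⟨e.symm y, e.map_target y.2⟩
  left_inv p := Subtype.ext (e.left_inv p.2)
  right_inv y := Subtype.ext (e.right_inv y.2)
  contMDiff_toFun := (ContMDiff.subtypeVal_comp_iff _ _).1
    ((contMDiffOn_of_mem_maximalAtlas he).comp_contMDiff contMDiff_subtype_val fun p => p.2)
  contMDiff_invFun := (ContMDiff.subtypeVal_comp_iff _ _).1
    ((contMDiffOn_symm_of_mem_maximalAtlas he).comp_contMDiff contMDiff_subtype_val fun p => p.2)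

theorem pullback_chartDiffeomorph (he : e ∈ IsManifold.maximalAtlas (𝓡 (2 * n)) ∞ M)
    {σ : TwoForm n M} {τ : TwoForm n (R2 n)}
    (hτ : ∀ p ∈ e.source, pullback (n := n) e τ p = σ p) :
    pullback (n := n) (chartDiffeomorph he) (restrictForm τ ⟨e.target, e.open_target⟩) =
      restrictForm σ ⟨e.source, e.open_source⟩ := by
  funext p
  have hφ : MDifferentiableAt (𝓡 (2 * n)) (𝓡 (2 * n)) (chartDiffeomorph he) p :=
    (chartDiffeomorph he).contMDiff.mdifferentiableAt (by simp)
  have hed : MDifferentiableAt (𝓡 (2 * n)) (𝓡 (2 * n)) e (p : M) :=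
    (contMDiffAt_of_mem_maximalAtlas he p.2).mdifferentiableAt (by simp)
  calc pullback (n := n) (chartDiffeomorph he) (restrictForm τ ⟨e.target, e.open_target⟩) p
      = pullback (n := n) (Subtype.val ∘ chartDiffeomorph he) τ p :=
        (pullback_comp_apply (contMDiff_subtype_val.mdifferentiableAt one_ne_zero) hφ τ).symm
    _ = pullback (n := n) (e ∘ Subtype.val) τ p := rfl
    _ = pullback (n := n) Subtype.val (pullback (n := n) e τ) p :=
        pullback_comp_apply hed (contMDiff_subtype_val.mdifferentiableAt one_ne_zero) τ
    _ = restrictForm σ ⟨e.source, e.open_source⟩ p :=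
        congrArg (fun α : R2 n [⋀^Fin 2]→L[ℝ] ℝ => α.compContinuousLinearMap
          (mfderiv (𝓡 (2 * n)) (𝓡 (2 * n)) Subtype.val p)) (hτ p p.2)

theorem isSmoothOnSubset_of_forall_eq {A : Set (R1 n)} {h : A → R1 n} (hh : ∀ a, h a = a) :
    IsSmoothOnSubset h :=
  fun _ => ⟨univ, id, isOpen_univ, mem_univ _, contDiffOn_id, fun b _ => (hh b).symm⟩

theorem isStrongSymplecticEquivalence_chartDiffeomorph
    (he : e ∈ IsManifold.maximalAtlas (𝓡 (2 * n)) ∞ M) {σ : TwoForm n M} {τ : TwoForm n (R2 n)}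
    (hτ : ∀ p ∈ e.source, pullback (n := n) e τ p = σ p) {f : M → R1 n} {G : R2 n → R1 n}
    (hG : ∀ p ∈ e.source, G (e p) = f p) :
    IsStrongSymplecticEquivalence (restrictForm σ ⟨e.source, e.open_source⟩)
      (restrictMap f ⟨e.source, e.open_source⟩) (restrictForm τ ⟨e.target, e.open_target⟩)
      (restrictMap G ⟨e.target, e.open_target⟩) (chartDiffeomorph he)
      (Equiv.setCongr (range_restrictMap_eq_of_forall_eq hG)) where
  symplectomorphism := pullback_chartDiffeomorph he hτ
  smooth := isSmoothOnSubset_of_forall_eq fun _ => rfl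
  smooth_symm := isSmoothOnSubset_of_forall_eq fun _ => rfl
  commutes p := hG p p.2

theorem isDarbouxCoordinates_of_chart (he : e ∈ IsManifold.maximalAtlas (𝓡 (2 * n)) ∞ M)
    {σ : TwoForm n M} (hσ : ∀ p ∈ e.source, pullback (n := n) e (canonicalForm n) p = σ p)
    {m : M} (hm : m ∈ e.source) (hem : e m = 0) {ξ : Fin n → M → ℝ}
    (hξ : ∀ p ∈ e.source, ∀ i, e p (xiIndex i) = ξ i p) :
    IsDarbouxCoordinates σ m ⟨e.source, e.open_source⟩ (fun i p => e p (xIndex i)) ξ := by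
  refine ⟨hm, ⟨e, he, rfl, hem, fun p hp i => ⟨rfl, hξ p hp i⟩⟩, fun p hp => ?_⟩
  have hed := (contMDiffAt_of_mem_maximalAtlas he hp).mdifferentiableAt (by simp)
  refine (hσ p hp).symm.trans ((pullback_canonicalForm hed).trans
    (Finset.sum_congr rfl fun i _ => ?_))
  have hξi : (fun q => e q (xiIndex i)) =ᶠ[nhds p] ξ i :=
    Filter.eventually_of_mem (e.open_source.mem_nhds hp) fun q hq => hξ q hq i
  exact congrArg (wedge · _) hξi.mfderiv_eq

end Charts

end DarbouxCaratheodory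

end

theorem mainTheorem11_general (n : ℕ) (M : Type*) [TopologicalSpace M]
    [ChartedSpace (DarbouxCaratheodory.R2 n) M] [IsManifold (𝓡 (2 * n)) ∞ M]
    (σ : DarbouxCaratheodory.TwoForm n M) (F : M → DarbouxCaratheodory.R1 n)
    (hσ : DarbouxCaratheodory.IsSymplectic σ) (hF : ContMDiff (𝓡 (2 * n)) (𝓡 n) ∞ F)
    (hinv : ∀ (i j : Fin n) (p : M),
      DarbouxCaratheodory.poissonBracket σ (fun q => F q i) (fun q => F q j) p = 0)
    (m : M) (hm : DarbouxCaratheodory.IsRegularPoint F m) :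
    (∃ (U : Opens M) (V : Opens (DarbouxCaratheodory.R2 n))
        (hmU : m ∈ U) (h0V : (0 : DarbouxCaratheodory.R2 n) ∈ V)
        (φ : U ≃ₘ^∞⟮𝓡 (2 * n), 𝓡 (2 * n)⟯ V)
        (hrange : range (DarbouxCaratheodory.restrictMap (fun p => F p - F m) U) =
          range (DarbouxCaratheodory.restrictMap (DarbouxCaratheodory.xiMap n) V)),
      φ ⟨m, hmU⟩ = ⟨0, h0V⟩ ∧
      DarbouxCaratheodory.IsStrongSymplecticEquivalence
        (DarbouxCaratheodory.restrictForm σ U)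
        (DarbouxCaratheodory.restrictMap (fun p => F p - F m) U)
        (DarbouxCaratheodory.restrictForm (DarbouxCaratheodory.canonicalForm n) V)
        (DarbouxCaratheodory.restrictMap (DarbouxCaratheodory.xiMap n) V)
        φ (Equiv.setCongr hrange)) ∧
    (∃ (U : Opens M) (x : Fin n → M → ℝ),
      DarbouxCaratheodory.IsDarbouxCoordinates σ m U x (fun i p => F p i - F m i)) := by
  obtain ⟨e, he, hme, hem, hξ, hσe⟩ := DarbouxCaratheodory.exists_darboux_chart hσ hF hinv hm
  constructor
  · exact ⟨_, _, hme, hem ▸ e.map_source hme, DarbouxCaratheodory.chartDiffeomorph he,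
      DarbouxCaratheodory.range_restrictMap_eq_of_forall_eq hξ, Subtype.ext hem,
      DarbouxCaratheodory.isStrongSymplecticEquivalence_chartDiffeomorph he hσe hξ⟩
  · exact ⟨_, _, DarbouxCaratheodory.isDarbouxCoordinates_of_chart he hσe hme hem
      fun p hp i => congr($(hξ p hp) i)⟩

theorem mainTheorem11 (n : ℕ) (M : Type*) [TopologicalSpace M]
    [ChartedSpace (DarbouxCaratheodory.R2 n) M] [IsManifold (𝓡 (2 * n)) ∞ M]
    (σ : DarbouxCaratheodory.TwoForm n M) (F : M → DarbouxCaratheodory.R1 n)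
    (hF : DarbouxCaratheodory.IsIntegrableSystem σ F)
    (m : M) (hm : DarbouxCaratheodory.IsRegularPoint F m) :
    (∃ (U : Opens M) (V : Opens (DarbouxCaratheodory.R2 n))
        (hmU : m ∈ U) (h0V : (0 : DarbouxCaratheodory.R2 n) ∈ V)
        (φ : U ≃ₘ^∞⟮𝓡 (2 * n), 𝓡 (2 * n)⟯ V)
        (hrange : range (DarbouxCaratheodory.restrictMap (fun p => F p - F m) U) =
          range (DarbouxCaratheodory.restrictMap (DarbouxCaratheodory.xiMap n) V)),
      φ ⟨m, hmU⟩ = ⟨0, h0V⟩ ∧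
      DarbouxCaratheodory.IsStrongSymplecticEquivalence
        (DarbouxCaratheodory.restrictForm σ U)
        (DarbouxCaratheodory.restrictMap (fun p => F p - F m) U)
        (DarbouxCaratheodory.restrictForm (DarbouxCaratheodory.canonicalForm n) V)
        (DarbouxCaratheodory.restrictMap (DarbouxCaratheodory.xiMap n) V)
        φ (Equiv.setCongr hrange)) ∧
    (∃ (U : Opens M) (x : Fin n → M → ℝ),
      DarbouxCaratheodory.IsDarbouxCoordinates σ m U x (fun i p => F p i - F m i)) :=
  mainTheorem11_general n M σ F hF.symplectic hF.smooth hF.involution m hm
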